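/- All Hilbert spaces are finite-dimensional, $\log$ is to base $2$, $\mathcal D(\mathcal H)$ is the set of normalized states on $\mathcal H$, $F(\rho,\sigma)=\|\sqrt\rho\sqrt\sigma\|_1$, $P(\rho,\sigma)=\sqrt{1-F(\rho,\sigma)^2}$, $D_{\max}(\rho\|\sigma)=\inf\{\lambda\in\mathbb R:\rho\le 2^\lambda\sigma\}$ (with $\inf\emptyset=\infty$), and $D^{\varepsilon}_{\max}(\rho\|\sigma)=\inf\{D_{\max}(\rho'\|\sigma):\rho'\text{ a state},\,P(\rho,\rho')\le\varepsilon\}$. **Resource theories.** A resource theory on $\mathcal H_1\otimes\dots\otimes\mathcal H_r$ ($r\ge 2$, registers $M_1,\dots,M_r$) consists of sets $\mathcal F_L\subseteq\mathcal D(\bigotimes_{i\in L}\mathcal H_i)$, one for each non-empty $L\subseteq\{1,\dots,r\}$, such that (a) each $\mathcal F_L$ is convex and closed; (b) $\mathcal F_{K}\otimes\mathcal F_{K'}\subseteq\mathcal F_{K\cup K'}$ for disjoint non-empty $K,K'$; (c) partial traces onto non-empty $K\subseteq L$ map $\mathcal F_L$ into $\mathcal F_K$; (d) the maximally mixed state of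 $M_r$ is in $\mathcal F_{\{r\}}$. The free operations $\mathcal U_L$ are the unitaries $U$ on $\bigotimes_{i\in L}\mathcal H_i$ such that $U\mathcal F_LU^\dagger\subseteq\mathcal F_L$ and $U^\dagger\mathcal F_LU\subseteq\mathcal F_L$. Fix a collection of systems (finite-dimensional Hilbert spaces). To every decomposition, consisting of finitely many (at least one) systems $\mathcal H_1,\dots,\mathcal H_{r-1}$ of the collection, repetitions allowed, followed by a register $\mathcal H_r$ of arbitrary positive dimension, let a resource theory be assigned such that for $j<r$ the set $\mathcal F_{\{j\}}$ depends only on the system $\mathcal H_j$. For a system $M$ write $\mathcal F_M$ for this set. **Assumption 1** (for a decomposition). There is an orthonormal basis $|1\rangle,\dots,|\ell_r\rangle$ of $\mathcal H_r$ such that $$\mathcal F_{\{1,\dots,r\}}=\operatorname{conv}\Big\{\tfrac1{\ell_r}\sum_j U_j\sigma U_j^\dagger\otimes|j\rangle\langle j|:\ \sigma\in\mathcal F_{\{1,\dots,r-1\}},\ U_j\in\mathcal U_{\{1,\dots,r-1\}}\Big\},$$ and the experimenter only performs operations of the form $\sum_jU_j\otimes|j\rangle\langle j|$ with all $U_j\in\mathcal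 U_{\{1,\dots,r-1\}}$. Moreover, if $\mathcal H_j=\mathcal H_1$ and $\mathcal F_{\{j\}}=\mathcal F_{\{1\}}$ for all $j<r$, then $\sigma_{M_1\dots M_r}\in\mathcal F_{\{1,\dots,r\}}$ implies $\sigma_{M_jM_1\dots M_{j-1}M_{j+1}\dots M_r}\in\mathcal F_{\{1,\dots,r\}}$ for all $j<r$. **Transformations.** An $\varepsilon$-transformation of a state $\rho_M$ with discarded register $J$ consists of a decomposition with $\mathcal H_1=M$, $\mathcal H_r=J$ and $E=\mathcal H_2\otimes\dots\otimes\mathcal H_{r-1}$, free states $\mu_{EJ}\in\mathcal F_{\{2,\dots,r\}}$ and $\sigma_{ME}\in\mathcal F_{\{1,\dots,r-1\}}$, and $U\in\mathcal U_{\{1,\dots,r\}}$ (of the above controlled form when Assumption 1 is in force) such that $\Theta_{MEJ}=U(\rho_M\otimes\mu_{EJ})U^\dagger$ satisfies $P(\Theta_{ME},\sigma_{ME})\le\varepsilon$. It is catalytic if $\mu_{EJ}=\mu_E\otimes\mu_J$ and $\sigma_{ME}=\sigma_M\otimes\mu_E$ for some states $\mu_E,\mu_J$ and some $\sigma_M\in\mathcal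 F_M$. **Theorem.** Let $\varepsilon,\delta>0$, let $\rho_M$ be a state on a system $M$, and let $k=\min_{\sigma\in\mathcal F_M}D^\varepsilon_{\max}(\rho_M\|\sigma)$; this minimum is attained (possibly with value $\infty$) if $\mathcal F_M\neq\emptyset$, and $k=\infty$ if $\mathcal F_M=\emptyset$. 1. (Achievability) Suppose that Assumption 1 holds for every decomposition, that $k<\infty$ and that $k+2\log\frac1\delta\ge 0$. Then there is a catalytic $(\varepsilon+\delta)$-transformation of $\rho_M$ with $|J|=\lfloor 2^{k+2\log(1/\delta)}\rfloor$. In particular $\log|J|\le k+2\log\frac1\delta$, with equality if $2^k/\delta^2$ is an integer. 2. (Converse) For every $\varepsilon$-transformation of $\rho_M$ in a decomposition for which Assumption 1 holds, $\log|J|\ge k$. 3. (Converse without Assumption 1) For every $\varepsilon$-transformation of $\rho_M$, $\log|J|\ge\frac12k$. -/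

import Mathlib

open scoped MatrixOrder ComplexOrder

noncomputable section

namespace Catalytic

universe u

/-! ### States, distances and entropies on finite-dimensional spaces -/

section States

variable {n : Type*} [Fintype n] [DecidableEq n]

/-- Normalized quantum states (density matrices). -/
def IsState (ρ : Matrix n n ℂ) : Prop :=
  ρ.PosSemidef ∧ ρ.trace = 1

/-- The trace norm `‖X‖₁ = Tr √(X† X)`. -/
def traceNorm (X : Matrix n n ℂ) : ℝ :=
  (CFC.sqrt (X.conjTranspose * X)).trace.re

/-- The fidelity `F(ρ, σ) = ‖√ρ √σ‖₁`. -/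
def fidelity (ρ σ : Matrix n n ℂ) : ℝ :=
  traceNorm (CFC.sqrt ρ * CFC.sqrt σ)

/-- The purified distance `P(ρ, σ) = √(1 - F(ρ, σ)²)`. -/
def purifiedDistance (ρ σ : Matrix n n ℂ) : ℝ :=
  Real.sqrt (1 - fidelity ρ σ ^ 2)

/-- The max-relative entropy `inf {x : ρ ≤ 2^x σ}`; it is `⊤` when no such `x` exists, that is,
when the support of `ρ` is not contained in that of `σ`. -/
def dMax (ρ σ : Matrix n n ℂ) : EReal :=
  ⨅ (x : ℝ) (_ : (((2 : ℝ) ^ x) • σ - ρ).PosSemidef), (x : EReal)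

/-- The smooth max-relative entropy: the infimum of `D_max(ρ'‖σ)` over all states `ρ'` with
`P(ρ, ρ') ≤ ε`. -/
def smoothDMax (ε : ℝ) (ρ σ : Matrix n n ℂ) : EReal :=
  ⨅ (ρ' : Matrix n n ℂ) (_ : IsState ρ' ∧ purifiedDistance ρ ρ' ≤ ε), dMax ρ' σ

/-- The infimum of the smooth max-relative entropy over a set `F` of states. -/
def resourceDMax (ε : ℝ) (ρ : Matrix n n ℂ) (F : Set (Matrix n n ℂ)) : EReal :=
  ⨅ σ ∈ F, smoothDMax ε ρ σ

end States

/-! ### Several registers: tensor products and partial traces -/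

section Registers

variable {I : Type*} [DecidableEq I] {d : I → ℕ}

/-- The computational basis of `⨂_{i ∈ L} ℂ^{d i}`. -/
abbrev Idx (d : I → ℕ) (L : Finset I) : Type _ := (i : L) → Fin (d i)

/-- Operators on `⨂_{i ∈ L} ℂ^{d i}`. -/
abbrev Op (d : I → ℕ) (L : Finset I) : Type _ := Matrix (Idx d L) (Idx d L) ℂ

/-- The entries of a basis vector on the registers `K ⊆ L`. -/
abbrev restrictIdx {K L : Finset I} (hK : K ⊆ L) (x : Idx d L) : Idx d K :=
  fun i => x ⟨i, hK i.2⟩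

/-- `A ⊗ B` as an operator on the registers `L`, meant for `L = K ⊔ K'`. -/
def tensor {K K' L : Finset I} (hK : K ⊆ L) (hK' : K' ⊆ L) (A : Op d K) (B : Op d K') :
    Op d L :=
  Matrix.of fun x y =>
    A (restrictIdx hK x) (restrictIdx hK y) * B (restrictIdx hK' x) (restrictIdx hK' y)

/-- The basis vector of `L` with entries `x` on `K` and `z` on `L \ K`. -/
def glue {K L : Finset I} (x : Idx d K) (z : Idx d (L \ K)) : Idx d L := fun i =>
  if h : (i : I) ∈ K then x ⟨i, h⟩ else z ⟨i, Finset.mem_sdiff.mpr ⟨i.2, h⟩⟩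

/-- The partial trace of an operator on `L` over the registers in `L \ K`. -/
def reduce {L : Finset I} (K : Finset I) (A : Op d L) : Op d K :=
  Matrix.of fun x y => ∑ z : Idx d (L \ K), A (glue x z) (glue y z)

/-- An operator on `ℂ^{d i}` as an operator on the one-register system `{i}`. -/
def single (i : I) (A : Matrix (Fin (d i)) (Fin (d i)) ℂ) : Op d {i} :=
  A.submatrix (fun x => x ⟨i, Finset.mem_singleton_self i⟩)
    (fun x => x ⟨i, Finset.mem_singleton_self i⟩)

end Registers

/-! ### Resource theories on a fixed decomposition

The decomposition has `r = e + 2` registers. The register `some i`, `i = 0, …, e`, is the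
`(i+1)`-st one, and `none` is the last one. -/

/-- The register `M`. -/
abbrev regM (e : ℕ) : Finset (Option (Fin (e + 1))) := {some 0}

/-- The register `J`. -/
abbrev regJ (e : ℕ) : Finset (Option (Fin (e + 1))) := {none}

/-- The registers `E`. -/
abbrev regE (e : ℕ) : Finset (Option (Fin (e + 1))) := Finset.univ \ {some 0, none}

/-- The registers `ME`, that is, all but the last. -/
abbrev regME (e : ℕ) : Finset (Option (Fin (e + 1))) := Finset.univ.erase none

/-- The registers `EJ`, that is, all but the first. -/
abbrev regEJ (e : ℕ) : Finset (Option (Fin (e + 1))) := Finset.univ.erase (some 0)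

/-- The register dimensions: `d 0, …, d e` and, for the last register, `ℓ`. -/
abbrev regDim {e : ℕ} (d : Fin (e + 1) → ℕ) (ℓ : ℕ) : Option (Fin (e + 1)) → ℕ
  | none => ℓ
  | some i => d i

/-- The free states of a resource theory on `ℂ^{d 0} ⊗ ⋯ ⊗ ℂ^{d e} ⊗ ℂ^ℓ`. Only the sets
`free L` with `L` non-empty have a meaning. -/
structure ResourceTheory {e : ℕ} (d : Fin (e + 1) → ℕ) (ℓ : ℕ) where
  free : (L : Finset (Option (Fin (e + 1)))) → Set (Op (regDim d ℓ) L)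
  isState : ∀ L, L.Nonempty → ∀ σ ∈ free L, IsState σ
  convex : ∀ L, L.Nonempty → Convex ℝ (free L)
  closed : ∀ L, L.Nonempty → IsClosed (free L)
  tensor_mem : ∀ (K K' L) (hK : K ⊆ L) (hK' : K' ⊆ L), K.Nonempty → K'.Nonempty →
    Disjoint K K' → K ∪ K' = L →
    ∀ σ ∈ free K, ∀ τ ∈ free K', tensor hK hK' σ τ ∈ free L
  reduce_mem : ∀ K L, K.Nonempty → K ⊆ L → ∀ σ ∈ free L, reduce K σ ∈ free K
  maxMixed_mem : single (none : Option (Fin (e + 1))) ((ℓ : ℂ)⁻¹ • 1) ∈ free {none}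

namespace ResourceTheory

variable {e : ℕ} {d : Fin (e + 1) → ℕ} {ℓ : ℕ} (T : ResourceTheory d ℓ)

/-- The free states of a single register, as matrices of size `d i`. -/
def freeSingle (i : Option (Fin (e + 1))) :
    Set (Matrix (Fin (regDim d ℓ i)) (Fin (regDim d ℓ i)) ℂ) :=
  {σ | single i σ ∈ T.free {i}}

/-- The free operations on the registers `L`: the unitaries `U` such that `U` and `U†` both
preserve the free states. -/
def freeOps (L : Finset (Option (Fin (e + 1)))) : Set (Op (regDim d ℓ) L) :=
  {U | U ∈ Matrix.unitaryGroup (Idx (regDim d ℓ) L) ℂ ∧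
    (∀ σ ∈ T.free L, U * σ * U.conjTranspose ∈ T.free L) ∧
    (∀ σ ∈ T.free L, U.conjTranspose * σ * U ∈ T.free L)}

/-- `∑_j A_j ⊗ |j⟩⟨j|_J` for operators `A_j` on all but the last register and an orthonormal
basis `|1⟩, …, |ℓ⟩` of the last one. -/
def blockSum (b : OrthonormalBasis (Fin ℓ) ℂ (EuclideanSpace ℂ (Fin ℓ)))
    (A : Fin ℓ → Op (regDim d ℓ) (regME e)) : Op (regDim d ℓ) Finset.univ :=
  ∑ j, tensor (Finset.subset_univ _) (Finset.subset_univ _) (A j)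
    (single (none : Option (Fin (e + 1)))
      (Matrix.of fun x y : Fin ℓ => b j x * star (b j y)))

/-- The operations `∑_j U_j ⊗ |j⟩⟨j|_J`, with the `U_j` free on all but the last register. -/
def controlledOps (b : OrthonormalBasis (Fin ℓ) ℂ (EuclideanSpace ℂ (Fin ℓ))) :
    Set (Op (regDim d ℓ) Finset.univ) :=
  {U | ∃ V : Fin ℓ → Op (regDim d ℓ) (regME e),
    (∀ j, V j ∈ T.freeOps (regME e)) ∧ U = blockSum b V}

/-- Relabelling of basis vectors when register `j` is moved to the front: the entry of the old
register `i` is read off at its new position (`j ↦ 0`, `i ↦ i + 1` for `i < j`, and `i ↦ i` for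
`i > j` and for the last register). -/
def toFront (hd : ∀ i, d i = d 0) (j : Fin (e + 1))
    (x : Idx (regDim d ℓ) Finset.univ) : Idx (regDim d ℓ) Finset.univ
  | ⟨none, _⟩ => x ⟨none, Finset.mem_univ _⟩
  | ⟨some i, _⟩ => Fin.cast ((hd (j.cycleRange i)).trans (hd i).symm)
      (x ⟨some (j.cycleRange i), Finset.mem_univ _⟩)

/-- The last register is a source of classical randomness with canonical basis `b`: the free
states of the whole system are the convex hull of the states
`(1/ℓ) ∑_j U_j σ U_j† ⊗ |j⟩⟨j|`, and, if all registers but the last have the same space and the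
same free states, then the free states of the whole system stay free when a register other than
the last is moved to the front. -/
structure ClassicalRandomness
    (b : OrthonormalBasis (Fin ℓ) ℂ (EuclideanSpace ℂ (Fin ℓ))) : Prop where
  free_eq : T.free Finset.univ = convexHull ℝ
    {τ | ∃ σ ∈ T.free (regME e), ∃ V : Fin ℓ → Op (regDim d ℓ) (regME e),
      (∀ j, V j ∈ T.freeOps (regME e)) ∧
      τ = (ℓ : ℂ)⁻¹ • blockSum b (fun j => V j * σ * (V j).conjTranspose)}
  permute : ∀ hd : ∀ i, d i = d 0,
    (∀ i, ∀ σ : Matrix (Fin (d 0)) (Fin (d 0)) ℂ,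
      σ ∈ T.freeSingle (some 0) ↔
        σ.submatrix (Fin.cast (hd i)) (Fin.cast (hd i)) ∈ T.freeSingle (some i)) →
    ∀ j, ∀ σ ∈ T.free Finset.univ, σ.submatrix (toFront hd j) (toFront hd j) ∈ T.free Finset.univ

/-- `μ` (on `EJ`), `U` (on `MEJ`) and `σ` (on `ME`) form a transformation of `ρ` (on `M`) to the
free states with error `ε`. The number of discarded qubits is `log₂ ℓ`. -/
def IsTransformation (ε : ℝ) (ρ : Matrix (Fin (d 0)) (Fin (d 0)) ℂ)
    (μ : Op (regDim d ℓ) (regEJ e)) (U : Op (regDim d ℓ) Finset.univ)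
    (σ : Op (regDim d ℓ) (regME e)) : Prop :=
  μ ∈ T.free (regEJ e) ∧ U ∈ T.freeOps Finset.univ ∧ σ ∈ T.free (regME e) ∧
    purifiedDistance
      (reduce (regME e)
        (U * tensor (K := regM e) (Finset.subset_univ _) (Finset.subset_univ _)
          (single (some 0) ρ) μ * U.conjTranspose)) σ ≤ ε

/-- A transformation is catalytic if `μ_{EJ} = μ_E ⊗ μ_J` and `σ_{ME} = σ_M ⊗ μ_E` with `σ_M`
free. -/
def IsCatalyticTransformation (ε : ℝ) (ρ : Matrix (Fin (d 0)) (Fin (d 0)) ℂ)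
    (μ : Op (regDim d ℓ) (regEJ e)) (U : Op (regDim d ℓ) Finset.univ)
    (σ : Op (regDim d ℓ) (regME e)) : Prop :=
  T.IsTransformation ε ρ μ U σ ∧
    ∃ (μE : Op (regDim d ℓ) (regE e)) (μJ : Op (regDim d ℓ) (regJ e))
      (σM : Op (regDim d ℓ) (regM e)),
      IsState μE ∧ IsState μJ ∧ σM ∈ T.free (regM e) ∧
      μ = tensor (by intro i; simp +contextual) (by intro i; simp +contextual) μE μJ ∧
      σ = tensor (by intro i; simp +contextual) (by intro i; simp +contextual) σM μE

end ResourceTheory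

/-! ### Resource theories on all decompositions -/

/-- A resource theory for every decomposition that the experimenter may choose. `S` is the
collection of available systems; a decomposition consists of systems `s 0, …, s e` in `S`,
followed by a last register of some dimension `ℓ > 0`. The free states of a single system from
`S` do not depend on the decomposition in which it appears as a register other than the last. -/
structure ResourceFramework (S : Type u) where
  dim : S → ℕ
  dim_pos : ∀ s, 0 < dim s
  free : (s : S) → Set (Matrix (Fin (dim s)) (Fin (dim s)) ℂ)
  theory : {e : ℕ} → (s : Fin (e + 1) → S) → (ℓ : ℕ) → 0 < ℓ →
    ResourceTheory (fun i => dim (s i)) ℓ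
  theory_freeSingle : ∀ {e : ℕ} (s : Fin (e + 1) → S) (ℓ : ℕ) (hℓ : 0 < ℓ) (i : Fin (e + 1)),
    (theory s ℓ hℓ).freeSingle (some i) = free (s i)

/-- A choice of a basis of the last register for every decomposition. -/
abbrev BasisChoice (S : Type u) : Type u :=
  {e : ℕ} → (Fin (e + 1) → S) → (ℓ : ℕ) →
    OrthonormalBasis (Fin ℓ) ℂ (EuclideanSpace ℂ (Fin ℓ))

end Catalytic

end

/-! Achievability is a convex-split argument. Let `σ` and a state `ρ'` near `ρ` attain the minimum,
so that `ρ' ≤ 2^k σ`. Take `n` copies of `M`, the first in state `ρ` and the others in `σ`, and a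
maximally mixed `J` of dimension `n`; controlled on the value `j` of `J`, move the first copy to
place `j`. Without `J`, the copies hold the uniform mixture over the possible places of `ρ`.
Replacing `ρ` by `ρ'` costs at most `ε`. Relative to `σ^{⊗n}`, the mixture for `ρ'` has as density
an average of `n` pairwise uncorrelated terms of mean `1` and second moment at most `2^k`. Its
second moment is thus at most `1 + (2^k - 1)/n`, and the fidelity with `σ^{⊗n}` is at least the
inverse square root of that (`inv_sqrt_le_fidelity_convexSplit`). For `δ < 1` the remaining distance
is at most `δ` once `n > 2^k/δ² - 1`, which the floor satisfies. The permutations used are free by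
`ClassicalRandomness.permute_mem_freeOps`.

For the converses, Uhlmann's theorem extends the target `σ_{ME}` to a state `τ` on `MEJ` that is
`ε`-close to the output `Θ`. If `τ ≤ c · σ ⊗ 1/ℓ`, then undoing `U` and tracing out `EJ` turns `τ`
into a state `ε`-close to `ρ` and `σ ⊗ 1/ℓ` into a free state of `M`, whence `k ≤ log c`
(`resourceDMax_le_of_posSemidef_sub`). The part of `τ` that is block diagonal in a basis of `J`
always lies below `σ ⊗ 1` (`posSemidef_sum_sub_pinching`). Under Assumption 1, `Θ` is itself block
diagonal, so `τ` may be pinched without moving away from `Θ`, and `c = ℓ`. In general the pinching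
inequality costs another factor `ℓ`, so `c = ℓ²`; this is the origin of the factor `1/2`.

Fidelity is handled through purifications written as matrices: `A` with `Aᴴ * A = ρ` purifies `ρ`,
and `Re Tr (A Bᴴ)` is the overlap. The two halves of Uhlmann's theorem, `re_trace_le_fidelity` and
`exists_re_trace_eq_fidelity`, yield the triangle inequality, monotonicity under channels,
extensions of states and compactness of balls; the last gives the minimum. -/

noncomputable section

namespace Catalytic

open Matrix

set_option linter.unusedSectionVars false

/-! ### Matrices with equal Gram matrices and polar decomposition -/

section Polar

variable {m n : Type*} [Fintype m] [DecidableEq m] [Fintype n] [DecidableEq n]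

theorem norm_toEuclideanLin_sq (A : Matrix m n ℂ) (v : EuclideanSpace ℂ n) :
    ((‖toEuclideanLin A v‖ ^ 2 : ℝ) : ℂ) = inner ℂ v (toEuclideanLin (Aᴴ * A) v) := by
  have h : toEuclideanLin (Aᴴ * A) v = toEuclideanLin Aᴴ (toEuclideanLin A v) := by
    ext i; simp [toLpLin_apply, mulVec_mulVec]
  rw [h, toEuclideanLin_conjTranspose_eq_adjoint, LinearMap.adjoint_inner_right]
  simp

/-- Two matrices with the same Gram matrix differ by a unitary on the left. -/
theorem exists_unitary_mul_of_gram_eq (A B : Matrix m n ℂ) (h : Aᴴ * A = Bᴴ * B) :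
    ∃ W : Matrix m m ℂ, Wᴴ * W = 1 ∧ A = W * B := by
  set f := toEuclideanLin A
  set g := toEuclideanLin B
  have hnorm : ∀ v, ‖f v‖ = ‖g v‖ := by
    intro v
    have h1 := norm_toEuclideanLin_sq A v
    rw [h, ← norm_toEuclideanLin_sq B v] at h1
    have h2 : ‖f v‖ ^ 2 = ‖g v‖ ^ 2 := by exact_mod_cast h1
    exact (sq_eq_sq₀ (norm_nonneg _) (norm_nonneg _)).mp h2
  -- `s` is a linear section of `g` over its range, so `f ∘ s` is the isometry `g v ↦ f v`; it
  -- remains to extend it to the whole space.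
  obtain ⟨s, hs⟩ := g.rangeRestrict.exists_rightInverse_of_surjective
    (LinearMap.range_eq_top.mpr g.surjective_rangeRestrict)
  have hgs : ∀ y, g (s y) = y := fun y => congrArg Subtype.val (LinearMap.congr_fun hs y)
  let L : LinearMap.range g →ₗᵢ[ℂ] EuclideanSpace ℂ m :=
    { toLinearMap := f ∘ₗ s
      norm_map' := fun y => by
        simp only [LinearMap.comp_apply, hnorm, hgs]; rfl }
  -- `s (g v)` and `v` differ by an element of `ker g`, which `f` also kills because the norms
  -- agree.
  have hL : ∀ v, L.extend (g v) = f v := by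
    intro v
    have h1 : L.extend (g v) = L ⟨g v, LinearMap.mem_range_self g v⟩ :=
      L.extend_apply ⟨g v, LinearMap.mem_range_self g v⟩
    have h2 : L ⟨g v, LinearMap.mem_range_self g v⟩ =
        f (s ⟨g v, LinearMap.mem_range_self g v⟩) := rfl
    rw [h1, h2, ← sub_eq_zero, ← map_sub, ← norm_eq_zero, hnorm, map_sub, hgs]
    simp
  refine ⟨toEuclideanLin.symm L.extend.toLinearMap, ?_, ?_⟩
  · apply toEuclideanLin.injective
    apply LinearMap.ext
    intro v
    apply ext_inner_left ℂ
    intro w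
    have h3 : ∀ X Y : Matrix m m ℂ, toEuclideanLin (X * Y) v =
        toEuclideanLin X (toEuclideanLin Y v) := by
      intro X Y; ext i; simp [toLpLin_apply, mulVec_mulVec]
    rw [h3, toEuclideanLin_conjTranspose_eq_adjoint, LinearMap.adjoint_inner_right]
    simp
  · apply toEuclideanLin.injective
    apply LinearMap.ext
    intro v
    have h3 : ∀ X : Matrix m m ℂ, toEuclideanLin (X * B) v =
        toEuclideanLin X (g v) := by
      intro X; ext i; simp [toLpLin_apply, mulVec_mulVec, g]
    rw [h3]
    simp [hL, f]

/-- A matrix with the Gram matrix of a square matrix `B` is `W * B` for an isometry `W`. -/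
theorem exists_isometry_mul_of_gram_eq (hmn : Fintype.card n ≤ Fintype.card m)
    (A : Matrix m n ℂ) (B : Matrix n n ℂ) (h : Aᴴ * A = Bᴴ * B) :
    ∃ W : Matrix m n ℂ, Wᴴ * W = 1 ∧ A = W * B := by
  obtain ⟨φ⟩ := Function.Embedding.nonempty_of_card_le hmn
  -- `J` embeds the smaller space isometrically, which makes `J * B` the same shape as `A`.
  let J : Matrix m n ℂ := (1 : Matrix m m ℂ).submatrix id φ
  have hJ : Jᴴ * J = 1 := by
    ext i j
    simp [J, mul_apply, one_apply, φ.injective.eq_iff, eq_comm]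
  obtain ⟨W, hW, hA⟩ := exists_unitary_mul_of_gram_eq A (J * B) (by
    rw [h, conjTranspose_mul, Matrix.mul_assoc, ← Matrix.mul_assoc Jᴴ, hJ, Matrix.one_mul])
  refine ⟨W * J, ?_, by rw [hA, Matrix.mul_assoc]⟩
  rw [conjTranspose_mul, Matrix.mul_assoc, ← Matrix.mul_assoc Wᴴ, hW, Matrix.one_mul, hJ]

end Polar

/-! ### Uhlmann's theorem, fidelity and purified distance -/

section Fidelity

variable {m n : Type*} [Fintype m] [DecidableEq m] [Fintype n] [DecidableEq n]

theorem posSemidef_sqrt (A : Matrix n n ℂ) : (CFC.sqrt A).PosSemidef :=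
  (CFC.sqrt_nonneg A).posSemidef

@[simp]
theorem conjTranspose_sqrt (A : Matrix n n ℂ) : (CFC.sqrt A)ᴴ = CFC.sqrt A :=
  (posSemidef_sqrt A).isHermitian

theorem sqrt_mul_sqrt {A : Matrix n n ℂ} (hA : A.PosSemidef) :
    CFC.sqrt A * CFC.sqrt A = A :=
  CFC.sqrt_mul_sqrt_self A hA.nonneg

theorem re_trace_nonneg {A : Matrix n n ℂ} (hA : A.PosSemidef) : 0 ≤ A.trace.re :=
  (Complex.nonneg_iff.mp hA.trace_nonneg).1

theorem re_trace_conjTranspose (A : Matrix n n ℂ) : (Aᴴ).trace.re = A.trace.re := by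
  simp [trace_conjTranspose]

theorem traceNorm_nonneg (X : Matrix n n ℂ) : 0 ≤ traceNorm X :=
  re_trace_nonneg (posSemidef_sqrt _)

theorem fidelity_nonneg (ρ σ : Matrix n n ℂ) : 0 ≤ fidelity ρ σ := traceNorm_nonneg _

/-- Polar decomposition of a square matrix. -/
theorem exists_polar (X : Matrix n n ℂ) :
    ∃ U : Matrix n n ℂ, Uᴴ * U = 1 ∧ X = U * CFC.sqrt (Xᴴ * X) := by
  refine exists_unitary_mul_of_gram_eq X _ ?_
  rw [conjTranspose_sqrt, sqrt_mul_sqrt (posSemidef_conjTranspose_mul_self X)]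

/-- The Hilbert–Schmidt inner product is at most the mean of the two squared norms. -/
theorem two_mul_re_trace_le (Y Z : Matrix m n ℂ) :
    2 * (Y * Zᴴ).trace.re ≤ (Yᴴ * Y).trace.re + (Zᴴ * Z).trace.re := by
  have h := re_trace_nonneg (posSemidef_conjTranspose_mul_self (Y - Z))
  have h1 : (Yᴴ * Z).trace.re = (Y * Zᴴ).trace.re := by
    rw [← re_trace_conjTranspose, conjTranspose_mul, conjTranspose_conjTranspose, trace_mul_comm]
  have h2 : (Zᴴ * Y).trace.re = (Y * Zᴴ).trace.re := by rw [trace_mul_comm]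
  simp only [conjTranspose_sub, Matrix.sub_mul, Matrix.mul_sub, trace_sub, Complex.sub_re,
    h1, h2] at h
  linarith

/-- Write `A = W a`, `B = V b` with isometries and `a b = U P` with `P = |a b|`. Then `A Bᴴ = (W U
√P) (V √P)ᴴ`, and both factors have squared Hilbert–Schmidt norm `Tr P`, which is the fidelity. -/
theorem re_trace_le_fidelity_of_card_le (hmn : Fintype.card n ≤ Fintype.card m)
    (A B : Matrix m n ℂ) : (A * Bᴴ).trace.re ≤ fidelity (Aᴴ * A) (Bᴴ * B) := by
  have hA := posSemidef_conjTranspose_mul_self A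
  have hB := posSemidef_conjTranspose_mul_self B
  obtain ⟨W, hW, hAW⟩ := exists_isometry_mul_of_gram_eq hmn A (CFC.sqrt (Aᴴ * A)) (by
    rw [conjTranspose_sqrt, sqrt_mul_sqrt hA])
  obtain ⟨V, hV, hBV⟩ := exists_isometry_mul_of_gram_eq hmn B (CFC.sqrt (Bᴴ * B)) (by
    rw [conjTranspose_sqrt, sqrt_mul_sqrt hB])
  set a := CFC.sqrt (Aᴴ * A)
  set b := CFC.sqrt (Bᴴ * B)
  obtain ⟨U, hU, hX⟩ := exists_polar (a * b)
  have hP := posSemidef_sqrt ((a * b)ᴴ * (a * b))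
  have hF : fidelity (Aᴴ * A) (Bᴴ * B) = (CFC.sqrt ((a * b)ᴴ * (a * b))).trace.re := rfl
  set P := CFC.sqrt ((a * b)ᴴ * (a * b))
  set Q := CFC.sqrt P
  have hQQ : Q * Q = P := sqrt_mul_sqrt hP
  have hQ : Qᴴ = Q := conjTranspose_sqrt P
  have hb : bᴴ = b := conjTranspose_sqrt _
  have key := two_mul_re_trace_le (W * U * Q) (V * Q)
  have e1 : (W * U * Q)ᴴ * (W * U * Q) = P := by
    calc (W * U * Q)ᴴ * (W * U * Q) = Qᴴ * (Uᴴ * (Wᴴ * W) * U) * Q := by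
          simp only [conjTranspose_mul, Matrix.mul_assoc]
      _ = P := by rw [hW, Matrix.mul_one, hU, Matrix.mul_one, hQ, hQQ]
  have e2 : (V * Q)ᴴ * (V * Q) = P := by
    calc (V * Q)ᴴ * (V * Q) = Qᴴ * (Vᴴ * V) * Q := by
          simp only [conjTranspose_mul, Matrix.mul_assoc]
      _ = P := by rw [hV, Matrix.mul_one, hQ, hQQ]
  have e3 : (W * U * Q) * (V * Q)ᴴ = A * Bᴴ := by
    calc (W * U * Q) * (V * Q)ᴴ = W * (U * (Q * Q)) * Vᴴ := by
          simp only [conjTranspose_mul, Matrix.mul_assoc, hQ]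
      _ = W * (a * b) * Vᴴ := by rw [hQQ, ← hX]
      _ = (W * a) * (V * b)ᴴ := by
          simp only [conjTranspose_mul, Matrix.mul_assoc, hb]
      _ = A * Bᴴ := by rw [← hAW, ← hBV]
  rw [e1, e2, e3] at key
  rw [hF]; linarith

/-- The easy half of Uhlmann's theorem. -/
theorem re_trace_le_fidelity (A B : Matrix m n ℂ) :
    (A * Bᴴ).trace.re ≤ fidelity (Aᴴ * A) (Bᴴ * B) := by
  -- Zero rows enlarge the purifying space without changing Gram matrices or the overlap.
  have h := re_trace_le_fidelity_of_card_le (m := m ⊕ n) (n := n) (by simp)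
    (fromRows A 0) (fromRows B 0)
  simpa [conjTranspose_fromRows_eq_fromCols_conjTranspose, fromCols_mul_fromRows, trace,
    diag, fromRows_mul, mul_fromCols] using h

/-- The hard half of Uhlmann's theorem. -/
theorem exists_re_trace_eq_fidelity (hmn : Fintype.card n ≤ Fintype.card m)
    (A : Matrix m n ℂ) {σ : Matrix n n ℂ} (hσ : σ.PosSemidef) :
    ∃ B : Matrix m n ℂ, Bᴴ * B = σ ∧ (A * Bᴴ).trace.re = fidelity (Aᴴ * A) σ := by
  have hA := posSemidef_conjTranspose_mul_self A
  obtain ⟨W, hW, hAW⟩ := exists_isometry_mul_of_gram_eq hmn A (CFC.sqrt (Aᴴ * A)) (by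
    rw [conjTranspose_sqrt, sqrt_mul_sqrt hA])
  set a := CFC.sqrt (Aᴴ * A) with ha
  set b := CFC.sqrt σ with hb
  obtain ⟨U, hU, hX⟩ := exists_polar (a * b)
  have hbb : bᴴ = b := conjTranspose_sqrt _
  -- This rotation of the purification turns the overlap into `Tr (Uᴴ a b) = Tr |a b|`.
  refine ⟨W * U * b, ?_, ?_⟩
  · calc (W * U * b)ᴴ * (W * U * b) = bᴴ * (Uᴴ * (Wᴴ * W) * U) * b := by
          simp only [conjTranspose_mul, Matrix.mul_assoc]
      _ = σ := by rw [hW, Matrix.mul_one, hU, Matrix.mul_one, hbb, sqrt_mul_sqrt hσ]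
  · have e : A * (W * U * b)ᴴ = W * (a * b) * Uᴴ * Wᴴ := by
      conv_lhs => rw [hAW]
      simp only [conjTranspose_mul, Matrix.mul_assoc, hbb]
    have e2 : Wᴴ * (W * (a * b) * Uᴴ) = a * b * Uᴴ := by
      simp only [← Matrix.mul_assoc, hW, Matrix.one_mul]
    have e3 : Uᴴ * (a * b) = CFC.sqrt ((a * b)ᴴ * (a * b)) := by
      conv_lhs => rw [hX, ← Matrix.mul_assoc, hU, Matrix.one_mul]
    rw [e, trace_mul_comm, e2, trace_mul_comm, e3]
    rfl

theorem exists_sqrt_mul_eq_fidelity {ρ σ : Matrix n n ℂ} (hρ : ρ.PosSemidef)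
    (hσ : σ.PosSemidef) :
    ∃ B : Matrix n n ℂ, Bᴴ * B = σ ∧ (CFC.sqrt ρ * Bᴴ).trace.re = fidelity ρ σ := by
  have h := exists_re_trace_eq_fidelity le_rfl (CFC.sqrt ρ) hσ
  rwa [conjTranspose_sqrt, sqrt_mul_sqrt hρ] at h

theorem re_trace_mul_conjTranspose_comm (A B : Matrix m n ℂ) :
    (A * Bᴴ).trace.re = (B * Aᴴ).trace.re := by
  rw [← re_trace_conjTranspose, conjTranspose_mul, conjTranspose_conjTranspose]

theorem fidelity_le_fidelity_swap {ρ σ : Matrix n n ℂ} (hρ : ρ.PosSemidef)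
    (hσ : σ.PosSemidef) : fidelity ρ σ ≤ fidelity σ ρ := by
  obtain ⟨B, hB, h⟩ := exists_sqrt_mul_eq_fidelity hρ hσ
  have := re_trace_le_fidelity B (CFC.sqrt ρ)
  rwa [hB, conjTranspose_sqrt, sqrt_mul_sqrt hρ, ← conjTranspose_sqrt ρ,
    re_trace_mul_conjTranspose_comm, h] at this

theorem fidelity_comm {ρ σ : Matrix n n ℂ} (hρ : ρ.PosSemidef)
    (hσ : σ.PosSemidef) : fidelity ρ σ = fidelity σ ρ :=
  le_antisymm (fidelity_le_fidelity_swap hρ hσ) (fidelity_le_fidelity_swap hσ hρ)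

theorem fidelity_le_one {ρ σ : Matrix n n ℂ} (hρ : IsState ρ) (hσ : IsState σ) :
    fidelity ρ σ ≤ 1 := by
  obtain ⟨B, hB, h⟩ := exists_sqrt_mul_eq_fidelity hρ.1 hσ.1
  have := two_mul_re_trace_le (CFC.sqrt ρ) B
  rw [hB, h, conjTranspose_sqrt, sqrt_mul_sqrt hρ.1, hρ.2, hσ.2] at this
  norm_num at this
  linarith

theorem purifiedDistance_le_one (ρ σ : Matrix n n ℂ) : purifiedDistance ρ σ ≤ 1 := by
  refine Real.sqrt_le_one.mpr ?_
  nlinarith [sq_nonneg (fidelity ρ σ)]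

theorem purifiedDistance_le_of_fidelity_le {ρ σ : Matrix n n ℂ} {ρ' σ' : Matrix m m ℂ}
    (h : fidelity ρ σ ≤ fidelity ρ' σ') : purifiedDistance ρ' σ' ≤ purifiedDistance ρ σ := by
  apply Real.sqrt_le_sqrt
  have := fidelity_nonneg ρ σ
  nlinarith

/-- Cauchy–Schwarz for the real part of the Hilbert–Schmidt product: the quadratic `‖t Y + Z‖²` in
`t` is nonnegative, so its discriminant is not positive. -/
theorem abs_re_trace_le (Y Z : Matrix m n ℂ) :
    |(Y * Zᴴ).trace.re| ≤ √(Yᴴ * Y).trace.re * √(Zᴴ * Z).trace.re := by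
  have hY := re_trace_nonneg (posSemidef_conjTranspose_mul_self Y)
  rw [← Real.sqrt_mul hY]
  apply Real.abs_le_sqrt
  have h : ∀ t : ℝ, 0 ≤ (Yᴴ * Y).trace.re * (t * t) + 2 * (Y * Zᴴ).trace.re * t +
      (Zᴴ * Z).trace.re := by
    intro t
    have h0 := two_mul_re_trace_le ((t : ℂ) • Y) (-Z)
    simp only [conjTranspose_smul, conjTranspose_neg, Matrix.smul_mul, Matrix.mul_smul,
      Matrix.mul_neg, Matrix.neg_mul, trace_smul, trace_neg, smul_eq_mul, Complex.neg_re,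
      Complex.star_def, Complex.conj_ofReal, Complex.re_ofReal_mul, neg_neg, mul_neg] at h0
    linarith
  have := discrim_le_zero h
  rw [discrim] at this
  nlinarith

/-- This is `cos (α + β) ≤ F(ρ, τ)` for the angles with `cos α = F(ρ, σ)` and `cos β = F(σ, τ)`.
Take purifications `B`, `C` of `ρ`, `τ` with optimal overlap with `√σ`, and apply Cauchy–Schwarz to
their components orthogonal to `√σ`. -/
theorem fidelity_mul_sub_le {ρ σ τ : Matrix n n ℂ} (hρ : IsState ρ) (hσ : IsState σ)
    (hτ : IsState τ) :
    fidelity ρ σ * fidelity σ τ - purifiedDistance ρ σ * purifiedDistance σ τ ≤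
      fidelity ρ τ := by
  obtain ⟨B, hB, hx⟩ := exists_sqrt_mul_eq_fidelity hσ.1 hρ.1
  obtain ⟨C, hC, hy⟩ := exists_sqrt_mul_eq_fidelity hσ.1 hτ.1
  rw [purifiedDistance, purifiedDistance, fidelity_comm hρ.1 hσ.1]
  have h0 := re_trace_le_fidelity B C
  rw [hB, hC] at h0
  refine le_trans ?_ h0
  have haa : CFC.sqrt σ * CFC.sqrt σ = σ := sqrt_mul_sqrt hσ.1
  have ha : (CFC.sqrt σ)ᴴ = CFC.sqrt σ := conjTranspose_sqrt σ
  set a := CFC.sqrt σ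
  set x := fidelity σ ρ
  set y := fidelity σ τ
  have hx' : (B * a).trace.re = x := by rw [← hx, ← re_trace_mul_conjTranspose_comm, ha]
  have hy' : (C * a).trace.re = y := by rw [← hy, ← re_trace_mul_conjTranspose_comm, ha]
  have hx2 : (a * B).trace.re = x := by rw [trace_mul_comm, hx']
  have hy2 : (a * C).trace.re = y := by rw [trace_mul_comm, hy']
  have hx3 : (Bᴴ * a).trace.re = x := by rw [trace_mul_comm, hx]
  have hy3 : (Cᴴ * a).trace.re = y := by rw [trace_mul_comm, hy]
  have key := abs_re_trace_le (B - (x : ℂ) • a) (C - (y : ℂ) • a)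
  have e1 : ((B - (x : ℂ) • a)ᴴ * (B - (x : ℂ) • a)).trace.re = 1 - x ^ 2 := by
    simp only [conjTranspose_sub, conjTranspose_smul, Complex.star_def, Complex.conj_ofReal, ha,
      Matrix.sub_mul, Matrix.mul_sub, Matrix.smul_mul, Matrix.mul_smul, trace_sub, trace_smul,
      smul_eq_mul, Complex.sub_re, Complex.re_ofReal_mul, hB, haa, hρ.2, hσ.2, hx2, hx3,
      Complex.one_re]
    ring
  have e2 : ((C - (y : ℂ) • a)ᴴ * (C - (y : ℂ) • a)).trace.re = 1 - y ^ 2 := by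
    simp only [conjTranspose_sub, conjTranspose_smul, Complex.star_def, Complex.conj_ofReal, ha,
      Matrix.sub_mul, Matrix.mul_sub, Matrix.smul_mul, Matrix.mul_smul, trace_sub, trace_smul,
      smul_eq_mul, Complex.sub_re, Complex.re_ofReal_mul, hC, haa, hτ.2, hσ.2, hy2, hy3,
      Complex.one_re]
    ring
  have e3 : ((B - (x : ℂ) • a) * (C - (y : ℂ) • a)ᴴ).trace.re = (B * Cᴴ).trace.re - x * y := by
    simp only [conjTranspose_sub, conjTranspose_smul, Complex.star_def, Complex.conj_ofReal, ha,
      Matrix.sub_mul, Matrix.mul_sub, Matrix.smul_mul, Matrix.mul_smul, trace_sub, trace_smul,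
      smul_eq_mul, Complex.sub_re, Complex.re_ofReal_mul, haa, hσ.2, hx', hy, Complex.one_re]
    ring
  rw [e1, e2, e3] at key
  linarith [neg_abs_le ((B * Cᴴ).trace.re - x * y)]

theorem purifiedDistance_sq {ρ σ : Matrix n n ℂ} (hρ : IsState ρ) (hσ : IsState σ) :
    purifiedDistance ρ σ ^ 2 = 1 - fidelity ρ σ ^ 2 :=
  Real.sq_sqrt (by nlinarith [fidelity_le_one hρ hσ, fidelity_nonneg ρ σ])

theorem purifiedDistance_nonneg (ρ σ : Matrix n n ℂ) : 0 ≤ purifiedDistance ρ σ :=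
  Real.sqrt_nonneg _

/-- The triangle inequality for the purified distance. -/
theorem purifiedDistance_triangle {ρ σ τ : Matrix n n ℂ} (hρ : IsState ρ) (hσ : IsState σ)
    (hτ : IsState τ) :
    purifiedDistance ρ τ ≤ purifiedDistance ρ σ + purifiedDistance σ τ := by
  have h := fidelity_mul_sub_le hρ hσ hτ
  have h1 := purifiedDistance_sq hρ hσ
  have h2 := purifiedDistance_sq hσ hτ
  have p1 := purifiedDistance_nonneg ρ σ
  have p2 := purifiedDistance_nonneg σ τ
  have f1 := fidelity_nonneg ρ σ
  have f2 := fidelity_nonneg σ τ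
  have g1 := fidelity_le_one hρ hσ
  have g2 := fidelity_le_one hσ hτ
  have f3 := fidelity_nonneg ρ τ
  generalize purifiedDistance ρ σ = p at *
  generalize purifiedDistance σ τ = q at *
  generalize fidelity ρ σ = x at *
  generalize fidelity σ τ = y at *
  rw [purifiedDistance]
  generalize fidelity ρ τ = z at *
  refine Real.sqrt_le_iff.mpr ⟨by positivity, ?_⟩
  have hxy : 0 ≤ x * y := mul_nonneg f1 f2
  have hpq : 0 ≤ p * q := mul_nonneg p1 p2
  -- Here `x, y` are the cosines and `p, q` the sines of two angles. In the first case the angles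
  -- add up to at least a right angle, and `p² + q² ≥ 1` suffices. In the second, `cos (α + β)` is
  -- positive and can be squared, and `sin (α + β) ≤ sin α + sin β`.
  rcases le_or_gt (x * y) (p * q) with hle | hlt
  · have hsq : (x * y) ^ 2 ≤ (p * q) ^ 2 := pow_le_pow_left₀ hxy hle 2
    have : 1 ≤ p ^ 2 + q ^ 2 := by
      have e : (x * y) ^ 2 = (1 - p ^ 2) * (1 - q ^ 2) := by rw [h1, h2]; ring
      nlinarith [mul_pow p q 2]
    nlinarith [sq_nonneg z]
  · have hz : (x * y - p * q) ^ 2 ≤ z ^ 2 := pow_le_pow_left₀ (by linarith) h 2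
    have e1 : (x * y) ^ 2 = (1 - p ^ 2) * (1 - q ^ 2) := by rw [h1, h2]; ring
    have e2 : x * y ≤ 1 := by nlinarith
    nlinarith [mul_nonneg hpq (sub_nonneg.mpr e2), mul_pow p q 2, sq_nonneg (p * q)]

/-- The fidelity does not decrease under a completely positive trace-preserving map. -/
theorem fidelity_le_fidelity_kraus {ι : Type*} [Fintype ι] [DecidableEq ι]
    (K : ι → Matrix m n ℂ) (hK : ∑ z, (K z)ᴴ * K z = 1) {ρ σ : Matrix n n ℂ}
    (hρ : ρ.PosSemidef) (hσ : σ.PosSemidef) :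
    fidelity ρ σ ≤ fidelity (∑ z, K z * ρ * (K z)ᴴ) (∑ z, K z * σ * (K z)ᴴ) := by
  obtain ⟨B, hB, h⟩ := exists_sqrt_mul_eq_fidelity hρ hσ
  -- The Stinespring dilation: `st A` keeps the environment index `z` on the purifying side, so it
  -- purifies the output, and trace preservation keeps overlaps.
  let st : Matrix n n ℂ → Matrix (ι × n) m ℂ := fun A => of fun z x => (A * (K z.1)ᴴ) z.2 x
  have hst : ∀ A, (st A)ᴴ * st A = ∑ z, K z * (Aᴴ * A) * (K z)ᴴ := by
    intro A
    have : ∀ z, K z * (Aᴴ * A) * (K z)ᴴ = (A * (K z)ᴴ)ᴴ * (A * (K z)ᴴ) := by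
      intro z; simp only [conjTranspose_mul, conjTranspose_conjTranspose, Matrix.mul_assoc]
    ext x y
    simp only [this, Matrix.sum_apply]
    rw [mul_apply, Fintype.sum_prod_type]
    rfl
  have htr : ∀ A C, (st A * (st C)ᴴ).trace = (A * Cᴴ).trace := by
    intro A C
    have h1 : (st A * (st C)ᴴ).trace = ∑ z, ((A * (K z)ᴴ) * (C * (K z)ᴴ)ᴴ).trace := by
      simp only [trace, diag, Fintype.sum_prod_type]
      rfl
    have h2 : ∀ z, (A * (K z)ᴴ) * (C * (K z)ᴴ)ᴴ = A * ((K z)ᴴ * K z) * Cᴴ := by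
      intro z; simp only [conjTranspose_mul, conjTranspose_conjTranspose, Matrix.mul_assoc]
    simp only [h1, h2]
    rw [← trace_sum, ← Matrix.sum_mul, ← Matrix.mul_sum, hK, Matrix.mul_one]
  have key := re_trace_le_fidelity (st (CFC.sqrt ρ)) (st B)
  rwa [htr, hst, hst, hB, conjTranspose_sqrt, sqrt_mul_sqrt hρ, h] at key

theorem purifiedDistance_kraus_le {ι : Type*} [Fintype ι] [DecidableEq ι]
    (K : ι → Matrix m n ℂ) (hK : ∑ z, (K z)ᴴ * K z = 1) {ρ σ : Matrix n n ℂ}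
    (hρ : ρ.PosSemidef) (hσ : σ.PosSemidef) :
    purifiedDistance (∑ z, K z * ρ * (K z)ᴴ) (∑ z, K z * σ * (K z)ᴴ) ≤ purifiedDistance ρ σ :=
  purifiedDistance_le_of_fidelity_le (fidelity_le_fidelity_kraus K hK hρ hσ)

theorem posSemidef_kraus {ι : Type*} [Fintype ι]
    (K : ι → Matrix m n ℂ) {ρ : Matrix n n ℂ} (hρ : ρ.PosSemidef) :
    (∑ z, K z * ρ * (K z)ᴴ).PosSemidef :=
  posSemidef_sum _ fun z _ => hρ.mul_mul_conjTranspose_same (K z)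

theorem trace_kraus {ι : Type*} [Fintype ι]
    (K : ι → Matrix m n ℂ) (hK : ∑ z, (K z)ᴴ * K z = 1) (ρ : Matrix n n ℂ) :
    (∑ z, K z * ρ * (K z)ᴴ).trace = ρ.trace := by
  have : ∀ z, (K z * ρ * (K z)ᴴ).trace = (((K z)ᴴ * K z) * ρ).trace := by
    intro z; rw [trace_mul_comm, ← Matrix.mul_assoc]
  simp only [trace_sum, this]
  rw [← trace_sum, ← Matrix.sum_mul, hK, Matrix.one_mul]

theorem IsState.kraus {ι : Type*} [Fintype ι]
    (K : ι → Matrix m n ℂ) (hK : ∑ z, (K z)ᴴ * K z = 1) {ρ : Matrix n n ℂ} (hρ : IsState ρ) :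
    IsState (∑ z, K z * ρ * (K z)ᴴ) :=
  ⟨posSemidef_kraus K hρ.1, by rw [trace_kraus K hK, hρ.2]⟩

/-- A state close to a marginal extends to a state at least as close to the whole. -/
theorem exists_extension {a c : Type*} [Fintype a] [DecidableEq a] [Fintype c] [DecidableEq c]
    [Nonempty c] (φ : a × c ≃ n) {ρ : Matrix n n ℂ} (hρ : ρ.PosSemidef) {σ : Matrix a a ℂ}
    (hσ : σ.PosSemidef) :
    ∃ σ' : Matrix n n ℂ, σ'.PosSemidef ∧
      (of fun x y => ∑ z, σ' (φ (x, z)) (φ (y, z))) = σ ∧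
      fidelity (of fun x y => ∑ z, ρ (φ (x, z)) (φ (y, z))) σ ≤ fidelity ρ σ' := by
  -- `fl` moves the factor `c` to the purifying side: a purification of `ρ` becomes one of its
  -- marginal, with overlaps unchanged. An optimal purification `B` of `σ` is then moved back as
  -- `B'`.
  let fl : Matrix n n ℂ → Matrix (n × c) a ℂ := fun A => of fun z x => A z.1 (φ (x, z.2))
  have hfl : ∀ A, (fl A)ᴴ * fl A = of fun x y => ∑ z, (Aᴴ * A) (φ (x, z)) (φ (y, z)) := by
    intro A; ext x y
    simp only [fl, mul_apply, Fintype.sum_prod_type, of_apply, conjTranspose_apply]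
    rw [Finset.sum_comm]
  have hcard : Fintype.card a ≤ Fintype.card (n × c) := by
    rw [Fintype.card_prod, ← Fintype.card_congr φ, Fintype.card_prod, mul_assoc]
    exact Nat.le_mul_of_pos_right _ (Nat.mul_pos Fintype.card_pos Fintype.card_pos)
  obtain ⟨B, hB, h⟩ := exists_re_trace_eq_fidelity hcard (fl (CFC.sqrt ρ)) hσ
  let B' : Matrix n n ℂ := of fun z y => B (z, (φ.symm y).2) (φ.symm y).1
  have hB' : fl B' = B := by ext ⟨z, w⟩ x; simp [fl, B']
  have htr : ∀ A C, (fl A * (fl C)ᴴ).trace = (A * Cᴴ).trace := by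
    intro A C
    simp only [fl, trace, diag, mul_apply, Fintype.sum_prod_type, of_apply, conjTranspose_apply]
    refine Finset.sum_congr rfl fun z _ => ?_
    rw [← φ.sum_comp, Fintype.sum_prod_type_right]
  refine ⟨B'ᴴ * B', posSemidef_conjTranspose_mul_self B', ?_, ?_⟩
  · rw [← hfl, hB', hB]
  · have key := re_trace_le_fidelity (CFC.sqrt ρ) B'
    rw [← htr, hB', h, hfl, conjTranspose_sqrt, sqrt_mul_sqrt hρ] at key
    exact key

end Fidelity

/-! ### Compactness and attainment of the minimum -/

section Attainment

variable {n : Type*} [Fintype n] [DecidableEq n]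

theorem isClosed_posSemidef : IsClosed {A : Matrix n n ℂ | A.PosSemidef} := by
  have h : {A : Matrix n n ℂ | A.PosSemidef} =
      {A | Aᴴ = A} ∩ ⋂ x : n → ℂ, {A | 0 ≤ star x ⬝ᵥ A *ᵥ x} := by
    ext A
    simp only [Set.mem_inter_iff, Set.mem_iInter, Set.mem_ofPred_eq,
      posSemidef_iff_dotProduct_mulVec, IsHermitian]
  rw [h]
  refine (isClosed_eq (by fun_prop) continuous_id).inter (isClosed_iInter fun x => ?_)
  exact isClosed_le continuous_const (by fun_prop)

/-- Describing states through their purifications `B` avoids continuity of the fidelity: the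
conditions on `B` are closed, and the trace condition bounds the entries. With `A = 0` the image is
the set of all states, and with `A = √ρ` it is a ball around `ρ`. -/
theorem isCompact_gram_image (A : Matrix n n ℂ) (c : ℝ) :
    IsCompact ((fun B : Matrix n n ℂ => Bᴴ * B) ''
      {B | (Bᴴ * B).trace = 1 ∧ c ≤ (A * Bᴴ).trace.re}) := by
  refine IsCompact.image ?_ (by fun_prop)
  have hbox : IsCompact (Set.pi Set.univ fun _ : n => Set.pi Set.univ fun _ : n =>
      Metric.closedBall (0 : ℂ) 1) :=
    isCompact_univ_pi fun _ => isCompact_univ_pi fun _ => isCompact_closedBall _ _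
  refine IsCompact.of_isClosed_subset hbox ?_ ?_
  · have h1 : IsClosed {B : Matrix n n ℂ | (Bᴴ * B).trace = 1} :=
      isClosed_eq (by fun_prop) continuous_const
    have h2 : IsClosed {B : Matrix n n ℂ | c ≤ (A * Bᴴ).trace.re} :=
      isClosed_le continuous_const (by fun_prop)
    exact h1.inter h2
  · rintro B ⟨hB, -⟩ i - j -
    rw [mem_closedBall_zero_iff]
    have h1 : (Bᴴ * B).trace.re = ∑ x, ∑ y, ‖B y x‖ ^ 2 := by
      simp only [trace, diag, mul_apply, conjTranspose_apply, Complex.re_sum]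
      refine Finset.sum_congr rfl fun x _ => Finset.sum_congr rfl fun y _ => ?_
      rw [Complex.star_def, ← Complex.normSq_eq_conj_mul_self, Complex.ofReal_re,
        Complex.normSq_eq_norm_sq]
    rw [hB, Complex.one_re] at h1
    have h2 : ‖B i j‖ ^ 2 ≤ ∑ y, ‖B y j‖ ^ 2 :=
      Finset.single_le_sum (f := fun y => ‖B y j‖ ^ 2) (fun _ _ => sq_nonneg _)
        (Finset.mem_univ i)
    have h3 : ∑ y, ‖B y j‖ ^ 2 ≤ ∑ x, ∑ y, ‖B y x‖ ^ 2 :=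
      Finset.single_le_sum (f := fun x => ∑ y, ‖B y x‖ ^ 2)
        (fun _ _ => Finset.sum_nonneg fun _ _ => sq_nonneg _) (Finset.mem_univ j)
    nlinarith [norm_nonneg (B i j)]

theorem isCompact_setOf_isState : IsCompact {ρ : Matrix n n ℂ | IsState ρ} := by
  convert isCompact_gram_image (0 : Matrix n n ℂ) 0 using 1
  ext ρ
  constructor
  · rintro ⟨h1, h2⟩
    refine ⟨CFC.sqrt ρ, ⟨?_, by simp⟩, ?_⟩
    · rw [conjTranspose_sqrt, sqrt_mul_sqrt h1, h2]
    · simp only [conjTranspose_sqrt, sqrt_mul_sqrt h1]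
  · rintro ⟨B, ⟨hB, -⟩, rfl⟩
    exact ⟨posSemidef_conjTranspose_mul_self B, hB⟩

theorem purifiedDistance_le_iff {ε : ℝ} (hε : 0 ≤ ε) (ρ σ : Matrix n n ℂ) :
    purifiedDistance ρ σ ≤ ε ↔ √(1 - ε ^ 2) ≤ fidelity ρ σ := by
  rw [purifiedDistance, Real.sqrt_le_left hε, Real.sqrt_le_left (fidelity_nonneg ρ σ)]
  constructor <;> intro h <;> linarith

/-- Balls of states for the purified distance are compact. -/
theorem isCompact_purifiedDistance_ball {ε : ℝ} (hε : 0 ≤ ε) {ρ : Matrix n n ℂ}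
    (hρ : IsState ρ) :
    IsCompact {ρ' : Matrix n n ℂ | IsState ρ' ∧ purifiedDistance ρ ρ' ≤ ε} := by
  convert isCompact_gram_image (CFC.sqrt ρ) (√(1 - ε ^ 2)) using 1
  ext ρ'
  simp only [Set.mem_ofPred_eq, purifiedDistance_le_iff hε]
  constructor
  · rintro ⟨h1, h2⟩
    obtain ⟨B, hB, h⟩ := exists_sqrt_mul_eq_fidelity hρ.1 h1.1
    exact ⟨B, ⟨by rw [hB, h1.2], by rwa [h]⟩, hB⟩
  · rintro ⟨B, ⟨hB, h⟩, rfl⟩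
    refine ⟨⟨posSemidef_conjTranspose_mul_self B, hB⟩, h.trans ?_⟩
    have := re_trace_le_fidelity (CFC.sqrt ρ) B
    rwa [conjTranspose_sqrt, sqrt_mul_sqrt hρ.1] at this

theorem one_le_of_posSemidef_smul_sub {c : ℝ} {ρ σ : Matrix n n ℂ} (hρ : IsState ρ)
    (hσ : IsState σ) (h : (c • σ - ρ).PosSemidef) : 1 ≤ c := by
  have := re_trace_nonneg h
  rw [trace_sub, trace_smul, hρ.2, hσ.2] at this
  simp at this
  linarith

theorem resourceDMax_le {ε x : ℝ} {ρ ρ' σ : Matrix n n ℂ} {F : Set (Matrix n n ℂ)}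
    (hσ : σ ∈ F) (hρ' : IsState ρ') (hP : purifiedDistance ρ ρ' ≤ ε)
    (h : (((2 : ℝ) ^ x) • σ - ρ').PosSemidef) : resourceDMax ε ρ F ≤ x :=
  (iInf₂_le σ hσ).trans ((iInf₂_le ρ' ⟨hρ', hP⟩).trans (iInf₂_le x h))

/-- The infimum in the smooth max-relative entropy of resource is attained, if it is finite. -/
theorem exists_resourceDMax_eq {ε : ℝ} (hε : 0 ≤ ε) {ρ : Matrix n n ℂ} (hρ : IsState ρ)
    {F : Set (Matrix n n ℂ)} (hF : IsClosed F) (hFs : ∀ σ ∈ F, IsState σ)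
    (h : resourceDMax ε ρ F ≠ ⊤) :
    ∃ (x : ℝ) (ρ' σ : Matrix n n ℂ), σ ∈ F ∧ IsState ρ' ∧ purifiedDistance ρ ρ' ≤ ε ∧
      (((2 : ℝ) ^ x) • σ - ρ').PosSemidef ∧ resourceDMax ε ρ F = x := by
  have h' := h.lt_top
  simp only [resourceDMax, smoothDMax, dMax, iInf_lt_iff] at h'
  obtain ⟨σ₁, hσ₁, ρ₁, hρ₁, x₁, hx₁, -⟩ := h'
  have hpos : ∀ {y : ℝ} {ρ' σ : Matrix n n ℂ}, IsState ρ' → σ ∈ F →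
      (((2 : ℝ) ^ y) • σ - ρ').PosSemidef → 0 ≤ y := by
    intro y ρ' σ h1 h2 h3
    have := one_le_of_posSemidef_smul_sub h1 (hFs σ h2) h3
    by_contra hy
    exact absurd this (not_le.mpr (Real.rpow_lt_one_of_one_lt_of_neg one_lt_two (not_le.mp hy)))
  -- Minimising jointly over exponent, smoothed state and free state replaces nested infima. The
  -- exponents lie in a compact interval: comparison of traces bounds them below by `0`, and one
  -- feasible point bounds those of interest above.
  let Z : Set (ℝ × Matrix n n ℂ × Matrix n n ℂ) :=
    (Set.Icc 0 x₁ ×ˢ {ρ' | IsState ρ' ∧ purifiedDistance ρ ρ' ≤ ε} ×ˢ F) ∩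
      {p | (((2 : ℝ) ^ p.1) • p.2.2 - p.2.1).PosSemidef}
  have hZ : IsCompact Z := by
    refine IsCompact.inter_right ?_ ?_
    · exact isCompact_Icc.prod ((isCompact_purifiedDistance_ball hε hρ).prod
        (isCompact_setOf_isState.of_isClosed_subset hF hFs))
    · refine isClosed_posSemidef.preimage
        (f := fun p : ℝ × Matrix n n ℂ × Matrix n n ℂ => ((2 : ℝ) ^ p.1) • p.2.2 - p.2.1) ?_
      have : Continuous fun p : ℝ × Matrix n n ℂ × Matrix n n ℂ => (2 : ℝ) ^ p.1 :=
        (Real.continuous_const_rpow two_ne_zero).comp continuous_fst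
      fun_prop
  obtain ⟨⟨x, ρ', σ⟩, ⟨⟨-, hρ', hσ⟩, hx⟩, hmin⟩ := hZ.exists_isMinOn
    ⟨(x₁, ρ₁, σ₁), ⟨⟨hpos hρ₁.1 hσ₁ hx₁, le_rfl⟩, hρ₁, hσ₁⟩, hx₁⟩ continuous_fst.continuousOn
  have hxmin : ∀ p ∈ Z, x ≤ p.1 := fun p hp => hmin hp
  refine ⟨x, ρ', σ, hσ, hρ'.1, hρ'.2, hx, le_antisymm (resourceDMax_le hσ hρ'.1 hρ'.2 hx) ?_⟩
  refine le_iInf₂ fun τ hτ => le_iInf₂ fun ω hω => le_iInf₂ fun y hy => ?_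
  rw [EReal.coe_le_coe_iff]
  rcases le_total y x₁ with hyx | hyx
  · exact hxmin (y, ω, τ) ⟨⟨⟨hpos hω.1 hτ hy, hyx⟩, hω, hτ⟩, hy⟩
  · exact (hxmin (x₁, ρ₁, σ₁)
      ⟨⟨⟨hpos hρ₁.1 hσ₁ hx₁, le_rfl⟩, hρ₁, hσ₁⟩, hx₁⟩).trans hyx

theorem exists_smoothDMax_eq_resourceDMax {ε : ℝ} (hε : 0 ≤ ε) {ρ : Matrix n n ℂ}
    (hρ : IsState ρ) {F : Set (Matrix n n ℂ)} (hF : IsClosed F) (hFs : ∀ σ ∈ F, IsState σ)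
    (hne : F.Nonempty) : ∃ σ ∈ F, smoothDMax ε ρ σ = resourceDMax ε ρ F := by
  by_cases h : resourceDMax ε ρ F = ⊤
  · obtain ⟨σ, hσ⟩ := hne
    exact ⟨σ, hσ, le_antisymm (h ▸ le_top) (iInf₂_le σ hσ)⟩
  · obtain ⟨x, ρ', σ, hσ, hρ', hP, hx, hEq⟩ := exists_resourceDMax_eq hε hρ hF hFs h
    exact ⟨σ, hσ, le_antisymm (hEq ▸ (iInf₂_le ρ' ⟨hρ', hP⟩).trans (iInf₂_le x hx))
      (iInf₂_le σ hσ)⟩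

end Attainment

/-! ### Factoring an operator through the square root of a dominating state -/

section PseudoInverse

variable {n : Type*} [Fintype n] [DecidableEq n]

/-- Functional calculus with `x ↦ x⁻¹`; the convention `0⁻¹ = 0` makes `x * x⁻¹ * x = x` hold on the
kernel too. -/
theorem exists_pseudoInverse {s : Matrix n n ℂ} (hs : s.IsHermitian) :
    ∃ p : Matrix n n ℂ, p.IsHermitian ∧ s * p = p * s ∧ s * p * s = s := by
  have hsa : IsSelfAdjoint s := hs
  have hc : ∀ f : ℝ → ℝ, ContinuousOn f (spectrum ℝ s) := fun f =>
    (Matrix.finite_real_spectrum (A := s)).continuousOn f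
  have hid : cfc (fun x : ℝ => x) s = s := cfc_id' ℝ s
  refine ⟨cfc (fun x : ℝ => x⁻¹) s, cfc_predicate _ s, ?_, ?_⟩
  · conv_lhs => enter [1]; rw [← hid]
    conv_rhs => enter [2]; rw [← hid]
    exact cfc_commute_cfc _ _ s
  · calc s * cfc (fun x : ℝ => x⁻¹) s * s
        = cfc (fun x : ℝ => x) s * cfc (fun x : ℝ => x⁻¹) s * cfc (fun x : ℝ => x) s := by
          rw [hid]
      _ = cfc (fun x : ℝ => x * x⁻¹ * x) s := by
          rw [← cfc_mul _ _ s (hc _) (hc _), ← cfc_mul _ _ s (hc _) (hc _)]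
      _ = s := by simp only [mul_inv_mul_cancel, hid]

/-- Operators dominated by a multiple of `σ` factor through the square root of `σ`. -/
theorem exists_sqrt_mul_mul_sqrt_eq {K : ℝ} {ρ σ : Matrix n n ℂ} (hρ : ρ.PosSemidef)
    (hσ : σ.PosSemidef) (hK : 0 ≤ K) (h : (K • σ - ρ).PosSemidef) :
    ∃ X : Matrix n n ℂ, X.PosSemidef ∧ (K • (1 : Matrix n n ℂ) - X).PosSemidef ∧
      CFC.sqrt σ * X * CFC.sqrt σ = ρ := by
  have hss : CFC.sqrt σ * CFC.sqrt σ = σ := sqrt_mul_sqrt hσ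
  have hs : (CFC.sqrt σ).IsHermitian := conjTranspose_sqrt σ
  set s := CFC.sqrt σ
  obtain ⟨p, hp, hcomm, hsps⟩ := exists_pseudoInverse hs
  set q := s * p with hq
  have hqh : qᴴ = q := by rw [hq, conjTranspose_mul, hs, hp, ← hcomm]
  have hqs : q * s = s := hsps
  have hsq : s * q = s := by rw [hcomm, ← Matrix.mul_assoc, hsps]
  have hqq : q * q = q := by
    conv_lhs => rw [hq, ← Matrix.mul_assoc, hsps]
  have h1q : (1 - q)ᴴ = 1 - q := by rw [conjTranspose_sub, conjTranspose_one, hqh]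
  -- `q` projects onto the support of `σ`. Compressing `ρ ≤ K σ` to the complement gives `0 ≤ (1 -
  -- q) ρ (1 - q) ≤ 0`.
  have hρq : ρ * (1 - q) = 0 := by
    have h1 := h.conjTranspose_mul_mul_same (1 - q)
    have h2 : (1 - q)ᴴ * (K • σ - ρ) * (1 - q) = -((1 - q)ᴴ * ρ * (1 - q)) := by
      have : σ * (1 - q) = 0 := by
        rw [← hss, Matrix.mul_sub, Matrix.mul_one, Matrix.mul_assoc, hsq, sub_self]
      rw [Matrix.mul_assoc, Matrix.sub_mul, Matrix.smul_mul, this, smul_zero, zero_sub,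
        Matrix.mul_neg, Matrix.mul_assoc]
    rw [h2] at h1
    have h3 := hρ.conjTranspose_mul_mul_same (1 - q)
    have h4 : (1 - q)ᴴ * ρ * (1 - q) = 0 :=
      le_antisymm (by simpa using h1.nonneg) h3.nonneg
    have h5 : (CFC.sqrt ρ * (1 - q))ᴴ * (CFC.sqrt ρ * (1 - q)) = 0 := by
      rw [← h4, conjTranspose_mul, conjTranspose_sqrt, Matrix.mul_assoc,
        ← Matrix.mul_assoc (CFC.sqrt ρ), sqrt_mul_sqrt hρ, Matrix.mul_assoc]
    rw [conjTranspose_mul_self_eq_zero] at h5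
    rw [← sqrt_mul_sqrt hρ, Matrix.mul_assoc, h5, Matrix.mul_zero]
  have hρq' : ρ * q = ρ := by
    rw [Matrix.mul_sub, Matrix.mul_one, sub_eq_zero] at hρq
    exact hρq.symm
  have hqρ : q * ρ = ρ := by
    have := congrArg conjTranspose hρq'
    rwa [conjTranspose_mul, hqh, hρ.isHermitian] at this
  have hps : p * s = q := hcomm.symm
  -- The density `σ^{-1/2} ρ σ^{-1/2}`, with inverse taken on the support; it is bounded by `K q ≤
  -- K`.
  refine ⟨p * ρ * p, ?_, ?_, ?_⟩
  · have := hρ.conjTranspose_mul_mul_same p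
    rwa [hp] at this
  · have h1 := h.conjTranspose_mul_mul_same p
    have h2 : pᴴ * (K • σ - ρ) * p = K • q - p * ρ * p := by
      have h3 : p * σ * p = q := by
        rw [← hss, ← Matrix.mul_assoc, hps, Matrix.mul_assoc, ← hq, hqq]
      rw [hp, Matrix.mul_sub, Matrix.sub_mul, Matrix.mul_smul, Matrix.smul_mul, h3]
    rw [h2] at h1
    have h3 : (K • (1 - q)).PosSemidef := by
      refine PosSemidef.smul ?_ hK
      have h4 : 1 - q = (1 - q)ᴴ * (1 - q) := by
        rw [h1q, Matrix.mul_sub, Matrix.sub_mul, Matrix.sub_mul, hqq]; simp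
      rw [h4]
      exact posSemidef_conjTranspose_mul_self _
    have h5 : K • (1 : Matrix n n ℂ) - p * ρ * p = (K • q - p * ρ * p) + K • (1 - q) := by
      rw [smul_sub]; abel
    rw [h5]
    exact h1.add h3
  · calc s * (p * ρ * p) * s = (s * p) * ρ * (p * s) := by simp only [Matrix.mul_assoc]
      _ = ρ := by rw [hps, ← hq, hqρ, hρq']

end PseudoInverse

/-! ### Tensor powers and the convex split lemma -/

section PiTensor

variable {ι a : Type*} [Fintype ι] [DecidableEq ι] [Fintype a] [DecidableEq a]

/-- The tensor product of a family of operators on the same space. -/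
def piTensor (A : ι → Matrix a a ℂ) : Matrix (ι → a) (ι → a) ℂ :=
  of fun x y => ∏ i, A i (x i) (y i)

theorem piTensor_mul (A B : ι → Matrix a a ℂ) :
    piTensor A * piTensor B = piTensor fun i => A i * B i := by
  ext x y
  simp only [piTensor, mul_apply, of_apply, ← Finset.prod_mul_distrib]
  rw [Finset.prod_univ_sum, Fintype.piFinset_univ]

theorem conjTranspose_piTensor (A : ι → Matrix a a ℂ) :
    (piTensor A)ᴴ = piTensor fun i => (A i)ᴴ := by
  ext x y
  simp [piTensor, star_prod]

theorem trace_piTensor (A : ι → Matrix a a ℂ) : (piTensor A).trace = ∏ i, (A i).trace := by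
  simp only [piTensor, trace, diag, of_apply]
  rw [Finset.prod_univ_sum, Fintype.piFinset_univ]

theorem posSemidef_piTensor {A : ι → Matrix a a ℂ} (hA : ∀ i, (A i).PosSemidef) :
    (piTensor A).PosSemidef := by
  have : piTensor A =
      (piTensor fun i => CFC.sqrt (A i))ᴴ * piTensor fun i => CFC.sqrt (A i) := by
    rw [conjTranspose_piTensor, piTensor_mul]
    congr 1
    funext i
    rw [conjTranspose_sqrt, sqrt_mul_sqrt (hA i)]
  rw [this]
  exact posSemidef_conjTranspose_mul_self _

theorem prod_trace_update {A : ι → Matrix a a ℂ} (hA : ∀ i, (A i).trace = 1) (j : ι)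
    (X : Matrix a a ℂ) : ∏ i, (Function.update A j X i).trace = X.trace := by
  rw [Finset.prod_eq_single j]
  · simp
  · intro i _ hi; simp [hi, hA]
  · simp

/-- The uniform mixture of the states that have `ρ` at one place and `σ` at all others. -/
def convexSplit (ι : Type*) [Fintype ι] [DecidableEq ι] (ρ σ : Matrix a a ℂ) :
    Matrix (ι → a) (ι → a) ℂ :=
  (Fintype.card ι : ℂ)⁻¹ • ∑ j, piTensor (Function.update (fun _ : ι => σ) j ρ)

variable [Nonempty ι]

theorem isState_convexSplit {ρ σ : Matrix a a ℂ} (hρ : IsState ρ) (hσ : IsState σ) :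
    IsState (convexSplit ι ρ σ) := by
  constructor
  · refine PosSemidef.smul (posSemidef_sum _ fun j _ => posSemidef_piTensor fun i => ?_)
      (by positivity)
    by_cases h : i = j
    · subst h; simpa using hρ.1
    · simpa [h] using hσ.1
  · simp only [convexSplit, trace_smul, trace_sum, trace_piTensor]
    simp [prod_trace_update fun _ => hσ.2, hρ.2]

theorem isState_piTensor {A : ι → Matrix a a ℂ} (hA : ∀ i, IsState (A i)) :
    IsState (piTensor A) :=
  ⟨posSemidef_piTensor fun i => (hA i).1, by
    rw [trace_piTensor]; exact Finset.prod_eq_one fun i _ => (hA i).2⟩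

/-- For fixed `σ` the convex split is a channel in `ρ`. Stacking over `j` the purifications with `A`
at place `j` and `√σ` elsewhere, weighted by `|ι|^{-1/2}`, purifies the mixture and preserves
overlaps. -/
theorem fidelity_le_fidelity_convexSplit {ρ ρ' σ : Matrix a a ℂ} (hρ : ρ.PosSemidef)
    (hρ' : ρ'.PosSemidef) (hσ : IsState σ) :
    fidelity ρ ρ' ≤ fidelity (convexSplit ι ρ σ) (convexSplit ι ρ' σ) := by
  obtain ⟨B, hB, h⟩ := exists_sqrt_mul_eq_fidelity hρ hρ'
  set N : ℝ := (Fintype.card ι : ℝ)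
  have hN : 0 < N := by simp only [N]; exact_mod_cast Fintype.card_pos
  let c : ℂ := ((√N)⁻¹ : ℝ)
  have hc : star c * c = (Fintype.card ι : ℂ)⁻¹ := by
    simp only [c, Complex.star_def, Complex.conj_ofReal]
    rw [← Complex.ofReal_mul, ← mul_inv, Real.mul_self_sqrt hN.le]
    simp [N]
  let P : Matrix a a ℂ → ι → Matrix (ι → a) (ι → a) ℂ := fun A j =>
    piTensor (Function.update (fun _ : ι => CFC.sqrt σ) j A)
  have hP : ∀ A C j, (P A j)ᴴ * P C j =
      piTensor (Function.update (fun _ : ι => σ) j (Aᴴ * C)) := by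
    intro A C j
    simp only [P, conjTranspose_piTensor, piTensor_mul]
    congr 1
    funext i
    by_cases hi : i = j
    · subst hi; simp
    · simp [hi, sqrt_mul_sqrt hσ.1]
  let st : Matrix a a ℂ → Matrix (ι × (ι → a)) (ι → a) ℂ := fun A =>
    of fun z x => c * P A z.1 z.2 x
  have hst : ∀ A, (st A)ᴴ * st A = convexSplit ι (Aᴴ * A) σ := by
    intro A
    ext x y
    have : ∀ j, piTensor (Function.update (fun _ : ι => σ) j (Aᴴ * A)) x y =
        ∑ w, star (P A j w x) * P A j w y := fun j => by
      rw [← hP]; rfl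
    simp only [convexSplit, Matrix.smul_apply, Matrix.sum_apply, this, mul_apply,
      Fintype.sum_prod_type, conjTranspose_apply, st, of_apply, smul_eq_mul, Finset.mul_sum,
      ← hc, star_mul']
    refine Finset.sum_congr rfl fun j _ => Finset.sum_congr rfl fun w _ => ?_
    ring
  have htr : ∀ A C, (st A * (st C)ᴴ).trace = (A * Cᴴ).trace := by
    intro A C
    have h1 : (st A * (st C)ᴴ).trace =
        (Fintype.card ι : ℂ)⁻¹ * ∑ j, (P A j * (P C j)ᴴ).trace := by
      simp only [trace, diag, mul_apply, Fintype.sum_prod_type, conjTranspose_apply, st, of_apply,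
        Finset.mul_sum, ← hc, star_mul']
      refine Finset.sum_congr rfl fun j _ => Finset.sum_congr rfl fun w _ =>
        Finset.sum_congr rfl fun v _ => ?_
      ring
    have h2 : ∀ j, (P A j * (P C j)ᴴ).trace = (A * Cᴴ).trace := by
      intro j
      rw [trace_mul_comm, hP, trace_piTensor, prod_trace_update fun _ => hσ.2, trace_mul_comm]
    simp [h1, h2]
  have key := re_trace_le_fidelity (st (CFC.sqrt ρ)) (st B)
  rwa [htr, hst, hst, hB, conjTranspose_sqrt, sqrt_mul_sqrt hρ, h] at key

/-- If `τ = S X S` and `ω = S S`, then the fidelity of `τ` and `ω` is at least `q ^ (-1/2)`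
for `q` the second moment `Tr (ω X²)`. -/
theorem inv_sqrt_le_fidelity {n : Type*} [Fintype n] [DecidableEq n] {S X : Matrix n n ℂ}
    (hS : S.IsHermitian) (hX : X.PosSemidef) (h1 : (S * X * S).trace.re = 1) {q : ℝ} (hq : 0 < q)
    (h2 : (S * (X * X) * S).trace.re ≤ q) :
    (√q)⁻¹ ≤ fidelity (S * X * S) (S * S) := by
  have hYY : CFC.sqrt X * CFC.sqrt X = X := sqrt_mul_sqrt hX
  have hY : (CFC.sqrt X).PosSemidef := posSemidef_sqrt X
  set Y := CFC.sqrt X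
  have hYh : Yᴴ = Y := hY.isHermitian
  have hF := re_trace_le_fidelity (Y * S) S
  have e1 : (Y * S)ᴴ * (Y * S) = S * X * S := by
    rw [conjTranspose_mul, hYh, hS, Matrix.mul_assoc, ← Matrix.mul_assoc Y, hYY,
      Matrix.mul_assoc]
  have e2 : Sᴴ * S = S * S := by rw [hS]
  have e3 : (Y * S * Sᴴ).trace = (S * Y * S).trace := by
    rw [hS, trace_mul_comm, ← Matrix.mul_assoc]
  rw [e1, e2, e3] at hF
  refine le_trans ?_ hF
  set c := √q with hc
  -- For scalars `y, c ≥ 0`, `y⁴ - 3c²y² + 2c³y = y (y - c)² (y + 2c) ≥ 0`. With `y = √X` and `c =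
  -- √q`, averaging gives `2c³ Tr (S √X S) ≥ 3c² - q = 2c²`; this replaces Hölder's inequality
  -- between the moments of `X`.
  have hcpos : 0 < c := Real.sqrt_pos.mpr hq
  have hcc : c ^ 2 = q := Real.sq_sqrt hq.le
  let Z : Matrix n n ℂ := Y - (c : ℂ) • 1
  have hZh : Zᴴ = Z := by simp [Z, hYh]
  have hA : ((Y * Z)ᴴ * (Y * Z)).PosSemidef := posSemidef_conjTranspose_mul_self _
  have hB : (Zᴴ * Y * Z).PosSemidef := hY.conjTranspose_mul_mul_same Z
  have hA' := re_trace_nonneg (hA.conjTranspose_mul_mul_same S)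
  have hB' := re_trace_nonneg (hB.conjTranspose_mul_mul_same S)
  have hsum : (Y * Z)ᴴ * (Y * Z) + ((2 * c : ℝ) : ℂ) • (Zᴴ * Y * Z) =
      X * X - ((3 * c ^ 2 : ℝ) : ℂ) • X + ((2 * c ^ 3 : ℝ) : ℂ) • Y := by
    rw [conjTranspose_mul, hZh, hYh, ← hYY]
    simp only [Z, Matrix.sub_mul, Matrix.mul_sub, Matrix.smul_mul, Matrix.mul_smul,
      Matrix.one_mul, Matrix.mul_one, smul_sub, smul_smul, Matrix.mul_assoc]
    push_cast
    module
  have hS3 : (Sᴴ * ((Y * Z)ᴴ * (Y * Z)) * S).trace.re + 2 * c * (Sᴴ * (Zᴴ * Y * Z) * S).trace.re =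
      (S * (X * X) * S).trace.re - 3 * c ^ 2 * (S * X * S).trace.re +
        2 * c ^ 3 * (S * Y * S).trace.re := by
    have := congrArg (fun W => (S * W * S).trace.re) hsum
    simp only [Matrix.mul_add, Matrix.mul_sub, Matrix.add_mul, Matrix.sub_mul, Matrix.smul_mul,
      Matrix.mul_smul, trace_add, trace_sub, trace_smul, smul_eq_mul, Complex.add_re,
      Complex.sub_re, Complex.re_ofReal_mul] at this
    rw [hS]
    exact this
  rw [h1] at hS3
  have h4 : 2 * c ^ 2 ≤ 2 * c ^ 3 * (S * Y * S).trace.re := by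
    have := mul_nonneg hcpos.le hB'
    nlinarith
  rw [inv_le_iff_one_le_mul₀ hcpos]
  have hc2 : 0 < 2 * c ^ 2 := by positivity
  nlinarith

theorem trace_mul_smul_sum_mul_self_mul {n : Type*} [Fintype n] (S : Matrix n n ℂ) (c : ℂ)
    (Y : ι → Matrix n n ℂ) :
    (S * ((c • ∑ j, Y j) * (c • ∑ j, Y j)) * S).trace =
      c * (c * ∑ i, ∑ j, (S * (Y i * Y j) * S).trace) := by
  have h : (∑ j, Y j) * (∑ j, Y j) = ∑ i, ∑ j, Y i * Y j := by
    rw [Matrix.sum_mul]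
    exact Finset.sum_congr rfl fun i _ => Matrix.mul_sum _ _ _
  rw [Matrix.smul_mul, Matrix.mul_smul (∑ j, Y j), h]
  simp only [Matrix.mul_smul, Matrix.smul_mul, trace_smul, smul_eq_mul, Matrix.mul_sum,
    Matrix.sum_mul, trace_sum]

/-- The convex split lemma. -/
theorem inv_sqrt_le_fidelity_convexSplit {ρ σ : Matrix a a ℂ} (hρ : IsState ρ) (hσ : IsState σ)
    {K : ℝ} (h : (K • σ - ρ).PosSemidef) :
    (√(1 + (K - 1) / Fintype.card ι))⁻¹ ≤
      fidelity (convexSplit ι ρ σ) (piTensor fun _ : ι => σ) := by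
  have hK1 := one_le_of_posSemidef_smul_sub hρ hσ h
  have hK0 : 0 ≤ K := zero_le_one.trans hK1
  obtain ⟨X₀, hX₀, hKX, hX₀ρ⟩ := exists_sqrt_mul_mul_sqrt_eq hρ.1 hσ.1 hK0 h
  have hss : CFC.sqrt σ * CFC.sqrt σ = σ := sqrt_mul_sqrt hσ.1
  have hs : (CFC.sqrt σ)ᴴ = CFC.sqrt σ := conjTranspose_sqrt σ
  set s := CFC.sqrt σ
  set N : ℂ := (Fintype.card ι : ℂ) with hN
  have hN0 : N ≠ 0 := by simp [N]
  let S : Matrix (ι → a) (ι → a) ℂ := piTensor fun _ : ι => s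
  let XX : ι → Matrix (ι → a) (ι → a) ℂ := fun j =>
    piTensor (Function.update (fun _ : ι => (1 : Matrix a a ℂ)) j X₀)
  let X : Matrix (ι → a) (ι → a) ℂ := N⁻¹ • ∑ j, XX j
  have hS : S.IsHermitian := by
    simp only [S, IsHermitian, conjTranspose_piTensor, hs]
  have hXpos : X.PosSemidef := by
    refine PosSemidef.smul (posSemidef_sum _ fun j _ => posSemidef_piTensor fun i => ?_)
      (by simp only [N]; positivity)
    by_cases hi : i = j
    · subst hi; simpa using hX₀
    · simpa [hi] using PosSemidef.one
  have hSS : S * S = piTensor fun _ : ι => σ := by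
    simp only [S, piTensor_mul, hss]
  have hSXS : S * X * S = convexSplit ι ρ σ := by
    simp only [X, convexSplit, Matrix.mul_smul, Matrix.smul_mul, Matrix.mul_sum, Matrix.sum_mul]
    congr 1
    refine Finset.sum_congr rfl fun j _ => ?_
    simp only [S, XX, piTensor_mul]
    congr 1
    funext i
    by_cases hi : i = j
    · subst hi; simp [hX₀ρ]
    · simp [hi, hss]
  have hσX : (σ * X₀).trace = 1 := by
    rw [← hss, Matrix.mul_assoc, trace_mul_comm, hX₀ρ, hρ.2]
  -- From `X₀ ≤ K` follows `X₀² ≤ K X₀`, and `X₀` has mean `1`.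
  have hσXX : (σ * (X₀ * X₀)).trace.re ≤ K := by
    have hr : CFC.sqrt X₀ * CFC.sqrt X₀ = X₀ := sqrt_mul_sqrt hX₀
    have hrh : (CFC.sqrt X₀)ᴴ = CFC.sqrt X₀ := conjTranspose_sqrt X₀
    have h1 := hKX.conjTranspose_mul_mul_same (CFC.sqrt X₀)
    have h2 : (CFC.sqrt X₀)ᴴ * (K • (1 : Matrix a a ℂ) - X₀) * CFC.sqrt X₀ =
        K • X₀ - X₀ * X₀ := by
      set r := CFC.sqrt X₀
      rw [hrh, ← hr]
      simp only [Matrix.mul_sub, Matrix.sub_mul, Matrix.mul_smul, Matrix.smul_mul,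
        Matrix.mul_one, Matrix.mul_assoc]
    rw [h2] at h1
    have h3 := re_trace_nonneg (h1.conjTranspose_mul_mul_same s)
    have h4 : (sᴴ * (K • X₀ - X₀ * X₀) * s).trace =
        K • (σ * X₀).trace - (σ * (X₀ * X₀)).trace := by
      rw [hs, trace_mul_comm, ← Matrix.mul_assoc, hss, Matrix.mul_sub, trace_sub,
        Matrix.mul_smul, trace_smul]
    rw [h4, hσX] at h3
    simp at h3
    linarith
  -- Distinct places are uncorrelated, so each of the `N (N - 1)` off-diagonal terms is `1`.
  have htr : ∀ i j, (S * (XX i * XX j) * S).trace =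
      if i = j then (σ * (X₀ * X₀)).trace else 1 := by
    intro i j
    rw [trace_mul_comm, ← Matrix.mul_assoc, hSS]
    simp only [XX, piTensor_mul, trace_piTensor]
    split_ifs with hij
    · subst hij
      rw [Finset.prod_eq_single i]
      · simp
      · intro k _ hk; simp [hk, hσ.2]
      · simp
    · refine Finset.prod_eq_one fun k _ => ?_
      by_cases hki : k = i
      · subst hki; simp [hij, hσX]
      · by_cases hkj : k = j
        · subst hkj; simp [hki, hσX]
        · simp [hki, hkj, hσ.2]
  have hcard : 0 < (Fintype.card ι : ℝ) := by exact_mod_cast Fintype.card_pos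
  have h2 : (S * (X * X) * S).trace.re ≤ 1 + (K - 1) / Fintype.card ι := by
    have e : (S * (X * X) * S).trace =
        N⁻¹ * (N⁻¹ * ∑ i, ∑ j, (S * (XX i * XX j) * S).trace) := trace_mul_smul_sum_mul_self_mul S N⁻¹ XX
    have e2 : ∀ i : ι, ∑ j, (if i = j then (σ * (X₀ * X₀)).trace else (1 : ℂ)) =
        (σ * (X₀ * X₀)).trace + (N - 1) := by
      intro i
      have : ∀ j, (if i = j then (σ * (X₀ * X₀)).trace else (1 : ℂ)) =
          (if i = j then ((σ * (X₀ * X₀)).trace - 1) else 0) + 1 := by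
        intro j; split_ifs <;> ring
      simp only [this, Finset.sum_add_distrib, Finset.sum_ite_eq, Finset.mem_univ, if_true]
      simp [N]
      ring
    have e3 : (S * (X * X) * S).trace = N⁻¹ * ((σ * (X₀ * X₀)).trace + (N - 1)) := by
      rw [e]
      simp only [htr, e2, Finset.sum_const, Finset.card_univ, nsmul_eq_mul, ← hN]
      field_simp
    have e4 : (S * (X * X) * S).trace.re =
        (Fintype.card ι : ℝ)⁻¹ * ((σ * (X₀ * X₀)).trace.re + (Fintype.card ι - 1)) := by
      have : N⁻¹ = (((Fintype.card ι : ℝ)⁻¹ : ℝ) : ℂ) := by simp [N]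
      rw [e3, this, Complex.re_ofReal_mul]
      simp [N]
    rw [e4, inv_mul_le_iff₀ hcard]
    field_simp
    linarith
  have hq : 0 < 1 + (K - 1) / Fintype.card ι := by
    have : 0 ≤ (K - 1) / Fintype.card ι := div_nonneg (by linarith) hcard.le
    linarith
  have key := inv_sqrt_le_fidelity hS hXpos
    (by rw [hSXS, (isState_convexSplit hρ hσ).2, Complex.one_re]) hq h2
  rwa [hSXS, hSS] at key

/-- With `n` places, the mixture is `δ`-close to the product state if `n > K / δ ^ 2 - 1`. -/
theorem purifiedDistance_convexSplit_le {ρ ρ' σ : Matrix a a ℂ} (hρ : IsState ρ)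
    (hρ' : IsState ρ') (hσ : IsState σ) {K ε δ : ℝ} (hε : 0 ≤ ε) (hδ : 0 < δ)
    (hP : purifiedDistance ρ ρ' ≤ ε)
    (h : (K • σ - ρ').PosSemidef) (hcard : K / δ ^ 2 < Fintype.card ι + 1) :
    purifiedDistance (convexSplit ι ρ σ) (piTensor fun _ : ι => σ) ≤ ε + δ := by
  -- For `δ ≥ 1` the bound is vacuous; for `δ < 1` the slack `1 - δ²` is what permits the `+ 1` in
  -- `hcard`.
  rcases le_or_gt 1 δ with h1 | h1
  · exact (purifiedDistance_le_one _ _).trans (by linarith)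
  have hK1 := one_le_of_posSemidef_smul_sub hρ' hσ h
  refine (purifiedDistance_triangle (isState_convexSplit hρ hσ) (isState_convexSplit hρ' hσ)
    (isState_piTensor fun _ => hσ)).trans (add_le_add ?_ ?_)
  · exact (purifiedDistance_le_of_fidelity_le
      (fidelity_le_fidelity_convexSplit hρ.1 hρ'.1 hσ)).trans hP
  · have hF := inv_sqrt_le_fidelity_convexSplit (ι := ι) hρ' hσ h
    have hN : 0 < (Fintype.card ι : ℝ) := by exact_mod_cast Fintype.card_pos
    set N : ℝ := (Fintype.card ι : ℝ)
    have hQ : 0 < 1 + (K - 1) / N := by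
      have : 0 ≤ (K - 1) / N := div_nonneg (by linarith) hN.le
      linarith
    rw [purifiedDistance, Real.sqrt_le_left hδ.le]
    have h2 : (1 + (K - 1) / N)⁻¹ ≤
        fidelity (convexSplit ι ρ' σ) (piTensor fun _ : ι => σ) ^ 2 := by
      have := pow_le_pow_left₀ (by positivity) hF 2
      rwa [inv_pow, Real.sq_sqrt hQ.le] at this
    have h3 : K < (N + 1) * δ ^ 2 := by rwa [div_lt_iff₀ (by positivity)] at hcard
    have hd : δ ^ 2 < 1 := by nlinarith
    have h4 : 1 - δ ^ 2 ≤ (1 + (K - 1) / N)⁻¹ := by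
      have e : (1 + (K - 1) / N)⁻¹ = N / (N + (K - 1)) := by field_simp
      rw [e, le_div_iff₀ (by linarith)]
      nlinarith
    linarith

end PiTensor

/-! ### Partial traces as channels with Kraus operators `1 ⊗ ⟨b j|` -/

section PartialTrace

variable {a c n : Type*} [Fintype a] [DecidableEq a] [Fintype c] [DecidableEq c]
  [Fintype n] [DecidableEq n]

/-- The partial trace over `c` for a splitting of the basis `n` as `a × c`. -/
def partialTrace (φ : a × c ≃ n) (X : Matrix n n ℂ) : Matrix a a ℂ :=
  of fun x y => ∑ z, X (φ (x, z)) (φ (y, z))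

/-- The operator `1 ⊗ ⟨b j|`. -/
def bra (φ : a × c ≃ n) (b : OrthonormalBasis c ℂ (EuclideanSpace ℂ c)) (j : c) :
    Matrix a n ℂ :=
  of fun x y => if (φ.symm y).1 = x then star (b j (φ.symm y).2) else 0

variable (φ : a × c ≃ n) (b : OrthonormalBasis c ℂ (EuclideanSpace ℂ c))

theorem sum_star_mul_basis (i j : c) : ∑ z, star (b i z) * b j z = if i = j then 1 else 0 := by
  rw [← OrthonormalBasis.inner_eq_ite b i j]
  simp [PiLp.inner_apply, mul_comm]

theorem sum_basis_mul_star (z w : c) : ∑ j, b j z * star (b j w) = if z = w then 1 else 0 := by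
  let B : Matrix c c ℂ := of fun j z => star (b j z)
  have h1 : B * Bᴴ = 1 := by
    ext i j
    simp only [B, mul_apply, of_apply, conjTranspose_apply, star_star, one_apply]
    exact sum_star_mul_basis b i j
  have h2 := mul_eq_one_comm.mp h1
  have h3 := congrFun (congrFun h2 z) w
  simpa only [B, mul_apply, of_apply, conjTranspose_apply, star_star, one_apply] using h3

theorem bra_mul_mul_bra_apply (X : Matrix n n ℂ) (i j : c) (x y : a) :
    (bra φ b i * X * (bra φ b j)ᴴ) x y =
      ∑ z, ∑ w, star (b i z) * X (φ (x, z)) (φ (y, w)) * b j w := by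
  have h1 : ∀ v, (bra φ b i * X) x v = ∑ z, star (b i z) * X (φ (x, z)) v := by
    intro v
    rw [mul_apply, ← φ.sum_comp, Fintype.sum_prod_type_right]
    refine Finset.sum_congr rfl fun z _ => ?_
    simp [bra]
  rw [mul_apply, ← φ.sum_comp, Fintype.sum_prod_type_right]
  refine Eq.trans (Finset.sum_congr rfl fun w _ => ?_) Finset.sum_comm
  simp only [h1]
  simp only [bra, conjTranspose_apply, of_apply, Equiv.symm_apply_apply, apply_ite star,
    star_star, star_zero, mul_ite, mul_zero, Finset.sum_ite_eq', Finset.mem_univ, if_true,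
    Finset.sum_mul]

theorem bra_conjTranspose_mul_mul_bra_apply (A : Matrix a a ℂ) (j : c) (x y : a) (z w : c) :
    ((bra φ b j)ᴴ * A * bra φ b j) (φ (x, z)) (φ (y, w)) =
      A x y * (b j z * star (b j w)) := by
  simp only [mul_apply, bra, conjTranspose_apply, of_apply, Equiv.symm_apply_apply, apply_ite star,
    star_star, star_zero, ite_mul, zero_mul, mul_ite, mul_zero, Finset.sum_ite_eq,
    Finset.mem_univ, if_true]
  ring

theorem bra_mul_conjTranspose_bra (i j : c) :
    bra φ b i * (bra φ b j)ᴴ = if i = j then 1 else 0 := by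
  ext x y
  rw [mul_apply, ← φ.sum_comp, Fintype.sum_prod_type_right]
  by_cases h : x = y
  · subst h
    have := sum_star_mul_basis b i j
    simp only [Complex.star_def] at this
    split_ifs at * <;> simp [bra, this]
  · split_ifs <;> simp [bra, h]

theorem sum_bra_mul_mul (X : Matrix n n ℂ) :
    ∑ j, bra φ b j * X * (bra φ b j)ᴴ = partialTrace φ X := by
  ext x y
  simp only [Matrix.sum_apply, bra_mul_mul_bra_apply, partialTrace, of_apply]
  rw [Finset.sum_comm]
  refine Finset.sum_congr rfl fun z _ => ?_
  rw [Finset.sum_comm]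
  have : ∀ w, ∑ j, star (b j z) * X (φ (x, z)) (φ (y, w)) * b j w =
      X (φ (x, z)) (φ (y, w)) * if w = z then 1 else 0 := by
    intro w
    rw [← sum_basis_mul_star b, Finset.mul_sum]
    exact Finset.sum_congr rfl fun j _ => by ring
  simp only [this]
  simp

theorem sum_conjTranspose_bra_mul_mul_apply (A : Matrix a a ℂ) (x y : a) (z w : c) :
    (∑ j, (bra φ b j)ᴴ * A * bra φ b j) (φ (x, z)) (φ (y, w)) =
      A x y * if z = w then 1 else 0 := by
  simp only [Matrix.sum_apply, bra_conjTranspose_mul_mul_bra_apply]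
  rw [← Finset.mul_sum, sum_basis_mul_star]

theorem sum_conjTranspose_bra_mul_bra : ∑ j, (bra φ b j)ᴴ * bra φ b j = 1 := by
  ext v w
  obtain ⟨⟨x, z⟩, rfl⟩ := φ.surjective v
  obtain ⟨⟨y, w⟩, rfl⟩ := φ.surjective w
  have := sum_conjTranspose_bra_mul_mul_apply φ b 1 x y z w
  simp only [Matrix.mul_one] at this
  rw [this]
  simp only [one_apply, φ.injective.eq_iff, Prod.mk.injEq]
  by_cases h1 : x = y <;> by_cases h2 : z = w <;> simp [h1, h2]

theorem trace_partialTrace (X : Matrix n n ℂ) : (partialTrace φ X).trace = X.trace := by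
  rw [← sum_bra_mul_mul φ (EuclideanSpace.basisFun c ℂ),
    trace_kraus _ (sum_conjTranspose_bra_mul_bra φ _)]

theorem posSemidef_partialTrace {X : Matrix n n ℂ} (hX : X.PosSemidef) :
    (partialTrace φ X).PosSemidef := by
  rw [← sum_bra_mul_mul φ (EuclideanSpace.basisFun c ℂ)]
  exact posSemidef_kraus _ hX

theorem purifiedDistance_partialTrace_le {ρ σ : Matrix n n ℂ} (hρ : ρ.PosSemidef)
    (hσ : σ.PosSemidef) :
    purifiedDistance (partialTrace φ ρ) (partialTrace φ σ) ≤ purifiedDistance ρ σ := by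
  rw [← sum_bra_mul_mul φ (EuclideanSpace.basisFun c ℂ),
    ← sum_bra_mul_mul φ (EuclideanSpace.basisFun c ℂ)]
  exact purifiedDistance_kraus_le _ (sum_conjTranspose_bra_mul_bra φ _) hρ hσ

theorem partialTrace_sub (X Y : Matrix n n ℂ) :
    partialTrace φ (X - Y) = partialTrace φ X - partialTrace φ Y := by
  ext x y; simp [partialTrace]

theorem partialTrace_smul (r : ℝ) (X : Matrix n n ℂ) :
    partialTrace φ (r • X) = r • partialTrace φ X := by
  ext x y; simp [partialTrace, Finset.mul_sum]

end PartialTrace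

/-! ### Pinching -/

section Pinching

variable {a c n : Type*} [Fintype a] [DecidableEq a] [Fintype c] [DecidableEq c]
  [Fintype n] [DecidableEq n]

/-- The pinching inequality. -/
theorem posSemidef_card_smul_sum_sub (P : c → Matrix n n ℂ) (hP : ∀ j, (P j).IsHermitian)
    (h1 : ∑ j, P j = 1) {X : Matrix n n ℂ} (hX : X.PosSemidef) :
    ((Fintype.card c : ℝ) • ∑ j, P j * X * P j - X).PosSemidef := by
  -- The difference is half a sum of the positive operators `(P i - P j) X (P i - P j)`; expanding
  -- needs only `∑ P j = 1`.
  have h : (2⁻¹ : ℝ) • ∑ i, ∑ j, (P i - P j)ᴴ * X * (P i - P j) =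
      (Fintype.card c : ℝ) • ∑ j, P j * X * P j - X := by
    have e : ∀ i j, (P i - P j)ᴴ * X * (P i - P j) =
        P i * X * P i + P j * X * P j - (P i * X * P j + P j * X * P i) := by
      intro i j
      rw [conjTranspose_sub, hP, hP]
      simp only [Matrix.sub_mul, Matrix.mul_sub]
      abel
    have e1 : ∑ i, ∑ j, P i * X * P j = X := by
      simp only [← Matrix.mul_sum, h1, Matrix.mul_one]
      rw [← Matrix.sum_mul, h1, Matrix.one_mul]
    have e2 : ∑ i, ∑ j, P j * X * P i = X := by
      rw [Finset.sum_comm]; exact e1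
    simp only [e, Finset.sum_sub_distrib, Finset.sum_add_distrib, e1, e2, Finset.sum_const,
      Finset.card_univ]
    rw [← Finset.smul_sum]
    simp only [← Nat.cast_smul_eq_nsmul ℝ]
    module
  rw [← h]
  refine PosSemidef.smul (posSemidef_sum _ fun i _ => posSemidef_sum _ fun j _ => ?_)
    (by norm_num)
  exact hX.conjTranspose_mul_mul_same _

/-- Only the positive terms with `i ≠ j` are left over. For `K j = 1 ⊗ ⟨b j|` this bounds the
pinched `X` by its marginal tensored with the identity. -/
theorem posSemidef_sum_sub_pinching (K : c → Matrix a n ℂ) {X : Matrix n n ℂ}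
    (hX : X.PosSemidef) :
    (∑ j, (K j)ᴴ * (∑ i, K i * X * (K i)ᴴ) * K j -
      ∑ j, ((K j)ᴴ * K j) * X * ((K j)ᴴ * K j)).PosSemidef := by
  rw [← Finset.sum_sub_distrib]
  refine posSemidef_sum _ fun j _ => ?_
  have : (K j)ᴴ * (∑ i, K i * X * (K i)ᴴ) * K j - ((K j)ᴴ * K j) * X * ((K j)ᴴ * K j) =
      (K j)ᴴ * (∑ i ∈ Finset.univ.erase j, K i * X * (K i)ᴴ) * K j := by
    rw [← Finset.add_sum_erase _ _ (Finset.mem_univ j), Matrix.mul_add, Matrix.add_mul]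
    simp only [Matrix.mul_assoc]
    abel
  rw [this]
  refine PosSemidef.conjTranspose_mul_mul_same (posSemidef_sum _ fun i _ => ?_) _
  exact hX.mul_mul_conjTranspose_same _

end Pinching

/-! ### Splitting a system into groups of registers -/

section Registers

variable {I : Type*} [DecidableEq I] {d : I → ℕ}

/-- The basis of a system split into two disjoint groups of registers. -/
def joinIdx {K K' L : Finset I} (hd : Disjoint K K') (hu : K ∪ K' = L) :
    Idx d K × Idx d K' ≃ Idx d L where
  toFun p i := if h : (i : I) ∈ K then p.1 ⟨i, h⟩ else
    p.2 ⟨i, by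
      have : (i : I) ∈ K ∪ K' := hu.symm ▸ i.2
      exact (Finset.mem_union.mp this).resolve_left h⟩
  invFun x := (restrictIdx (hu ▸ Finset.subset_union_left) x,
    restrictIdx (hu ▸ Finset.subset_union_right) x)
  left_inv p := by
    ext i
    · simp [restrictIdx]
    · have : (i : I) ∉ K := Finset.disjoint_right.mp hd i.2
      simp [restrictIdx, this]
  right_inv x := by
    ext i
    by_cases h : (i : I) ∈ K <;> simp [restrictIdx, h]

theorem restrictIdx_joinIdx_left {K K' L : Finset I} (hd : Disjoint K K') (hu : K ∪ K' = L)
    (hK : K ⊆ L) (p : Idx d K × Idx d K') : restrictIdx hK (joinIdx hd hu p) = p.1 :=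
  congrArg Prod.fst ((joinIdx hd hu).symm_apply_apply p)

theorem restrictIdx_joinIdx_right {K K' L : Finset I} (hd : Disjoint K K') (hu : K ∪ K' = L)
    (hK' : K' ⊆ L) (p : Idx d K × Idx d K') : restrictIdx hK' (joinIdx hd hu p) = p.2 :=
  congrArg Prod.snd ((joinIdx hd hu).symm_apply_apply p)

theorem tensor_joinIdx {K K' L : Finset I} (hd : Disjoint K K') (hu : K ∪ K' = L)
    (hK : K ⊆ L) (hK' : K' ⊆ L) (A : Op d K) (B : Op d K') (p q : Idx d K × Idx d K') :
    tensor hK hK' A B (joinIdx hd hu p) (joinIdx hd hu q) = A p.1 q.1 * B p.2 q.2 := by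
  simp only [tensor, of_apply, restrictIdx_joinIdx_left, restrictIdx_joinIdx_right]

theorem reduce_eq_partialTrace {K K' L : Finset I} (hd : Disjoint K K') (hu : K ∪ K' = L)
    (X : Op d L) : reduce K X = partialTrace (joinIdx hd hu) X := by
  obtain rfl : K' = L \ K := by rw [← hu, Finset.union_sdiff_cancel_left hd]
  rfl

/-- The basis of a single register. -/
def singleIdx (i : I) : Idx d {i} ≃ Fin (d i) where
  toFun x := x ⟨i, Finset.mem_singleton_self i⟩
  invFun y j := Fin.cast (by rw [Finset.mem_singleton.mp j.2]) y
  left_inv x := by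
    funext ⟨j, hj⟩
    obtain rfl := Finset.mem_singleton.mp hj
    rfl
  right_inv y := rfl

theorem single_submatrix_singleIdx (i : I) (X : Op d {i}) :
    single i (X.submatrix (singleIdx i).symm (singleIdx i).symm) = X := by
  have : single i (X.submatrix (singleIdx i).symm (singleIdx i).symm) =
    X.submatrix ((singleIdx i).symm ∘ singleIdx i) ((singleIdx i).symm ∘ singleIdx i) := rfl
  rw [this]
  simp

theorem single_eq_submatrix (i : I) (A : Matrix (Fin (d i)) (Fin (d i)) ℂ) :
    single i A = A.submatrix (singleIdx i) (singleIdx i) := rfl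

theorem isState_single_iff (i : I) (A : Matrix (Fin (d i)) (Fin (d i)) ℂ) :
    IsState (single i A) ↔ IsState A := by
  rw [single_eq_submatrix, IsState, IsState, posSemidef_submatrix_equiv]
  have : (A.submatrix (singleIdx i) (singleIdx i)).trace = A.trace := by
    simp only [trace, diag, submatrix_apply]
    exact (singleIdx i).sum_comp fun x => A x x
  rw [this]

theorem continuous_single (i : I) :
    Continuous (single (d := d) i) := by
  unfold single
  fun_prop

/-- A system with a last factor consisting of one register. -/
def joinSingle {K L : Finset I} {i : I} (hd : Disjoint K {i}) (hu : K ∪ {i} = L) :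
    Idx d K × Fin (d i) ≃ Idx d L :=
  ((Equiv.refl _).prodCongr (singleIdx i).symm).trans (joinIdx hd hu)

/-- A system with a first factor consisting of one register. -/
def singleJoin {K' L : Finset I} {i : I} (hd : Disjoint {i} K') (hu : {i} ∪ K' = L) :
    Fin (d i) × Idx d K' ≃ Idx d L :=
  ((singleIdx i).symm.prodCongr (Equiv.refl _)).trans (joinIdx hd hu)

theorem tensor_joinSingle {K L : Finset I} {i : I} (hd : Disjoint K {i}) (hu : K ∪ {i} = L)
    (hK : K ⊆ L) (hK' : {i} ⊆ L) (A : Op d K) (B : Matrix (Fin (d i)) (Fin (d i)) ℂ)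
    (p q : Idx d K × Fin (d i)) :
    tensor hK hK' A (single i B) (joinSingle hd hu p) (joinSingle hd hu q) =
      A p.1 q.1 * B p.2 q.2 :=
  tensor_joinIdx hd hu hK hK' A (single i B) _ _

theorem tensor_singleJoin {K' L : Finset I} {i : I} (hd : Disjoint {i} K') (hu : {i} ∪ K' = L)
    (hK : {i} ⊆ L) (hK' : K' ⊆ L) (A : Matrix (Fin (d i)) (Fin (d i)) ℂ) (B : Op d K')
    (p q : Fin (d i) × Idx d K') :
    tensor hK hK' (single i A) B (singleJoin hd hu p) (singleJoin hd hu q) =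
      A p.1 q.1 * B p.2 q.2 :=
  tensor_joinIdx hd hu hK hK' (single i A) B _ _

theorem reduce_eq_partialTrace_joinSingle {K L : Finset I} {i : I} (hd : Disjoint K {i})
    (hu : K ∪ {i} = L) (X : Op d L) : reduce K X = partialTrace (joinSingle hd hu) X := by
  rw [reduce_eq_partialTrace hd hu]
  ext x y
  exact ((singleIdx i).symm.sum_comp fun z =>
    X (joinIdx hd hu (x, z)) (joinIdx hd hu (y, z))).symm

theorem reduce_eq_single_partialTrace {K' L : Finset I} {i : I} (hd : Disjoint {i} K')
    (hu : {i} ∪ K' = L) (X : Op d L) :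
    reduce {i} X = single i (partialTrace (singleJoin hd hu) X) := by
  rw [reduce_eq_partialTrace hd hu]
  ext x y
  simp [single_eq_submatrix, partialTrace, singleJoin]

end Registers

/-! ### The splittings `ME | J` and `M | EJ` -/

section Decomposition

variable {e : ℕ} {d : Fin (e + 1) → ℕ} {ℓ : ℕ}

theorem disjoint_regME_none : Disjoint (regME e) {none} := by simp [regME]

theorem regME_union_none : regME e ∪ {none} = Finset.univ := by
  ext i; by_cases h : i = none <;> simp [regME, h]

theorem disjoint_regM_regEJ : Disjoint {some 0} (regEJ e) := by simp [regEJ]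

theorem regM_union_regEJ : {some 0} ∪ regEJ e = Finset.univ := by
  ext i; by_cases h : i = some 0 <;> simp [regEJ, h]

/-- The whole system as the last register next to all others. -/
def splitLast (d : Fin (e + 1) → ℕ) (ℓ : ℕ) :
    Idx (regDim d ℓ) (regME e) × Fin ℓ ≃ Idx (regDim d ℓ) Finset.univ :=
  joinSingle (d := regDim d ℓ) (i := none) disjoint_regME_none regME_union_none

/-- The whole system as the first register next to all others. -/
def splitFirst (d : Fin (e + 1) → ℕ) (ℓ : ℕ) :
    Fin (d 0) × Idx (regDim d ℓ) (regEJ e) ≃ Idx (regDim d ℓ) Finset.univ :=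
  singleJoin (d := regDim d ℓ) (i := some 0) disjoint_regM_regEJ regM_union_regEJ

theorem tensor_splitLast (A : Op (regDim d ℓ) (regME e)) (B : Matrix (Fin ℓ) (Fin ℓ) ℂ)
    (x y : Idx (regDim d ℓ) (regME e)) (z w : Fin ℓ) :
    tensor (Finset.subset_univ _) (Finset.subset_univ _) A (single none B)
      (splitLast d ℓ (x, z)) (splitLast d ℓ (y, w)) = A x y * B z w :=
  tensor_joinSingle (d := regDim d ℓ) (i := none) disjoint_regME_none regME_union_none _ _ A B (x, z) (y, w)

theorem tensor_splitFirst (A : Matrix (Fin (d 0)) (Fin (d 0)) ℂ)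
    (B : Op (regDim d ℓ) (regEJ e)) (x y : Fin (d 0)) (z w : Idx (regDim d ℓ) (regEJ e)) :
    tensor (K := regM e) (Finset.subset_univ _) (Finset.subset_univ _) (single (some 0) A) B
      (splitFirst d ℓ (x, z)) (splitFirst d ℓ (y, w)) = A x y * B z w :=
  tensor_singleJoin (d := regDim d ℓ) (i := some 0) disjoint_regM_regEJ regM_union_regEJ _ _ A B (x, z) (y, w)

theorem reduce_regME (X : Op (regDim d ℓ) Finset.univ) :
    reduce (regME e) X = partialTrace (splitLast d ℓ) X :=
  reduce_eq_partialTrace_joinSingle (d := regDim d ℓ) (i := none) disjoint_regME_none regME_union_none X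

theorem reduce_regM (X : Op (regDim d ℓ) Finset.univ) :
    reduce (regM e) X = single (some 0) (partialTrace (splitFirst d ℓ) X) :=
  reduce_eq_single_partialTrace (d := regDim d ℓ) (i := some 0) disjoint_regM_regEJ
    regM_union_regEJ X

theorem partialTrace_tensor_splitFirst (A : Matrix (Fin (d 0)) (Fin (d 0)) ℂ)
    (B : Op (regDim d ℓ) (regEJ e)) :
    partialTrace (splitFirst d ℓ) (tensor (K := regM e) (Finset.subset_univ _)
      (Finset.subset_univ _) (single (some 0) A) B) = B.trace • A := by
  ext x y
  simp only [partialTrace, of_apply, tensor_splitFirst, trace, diag, Matrix.smul_apply,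
    smul_eq_mul]
  rw [Finset.sum_mul]
  exact Finset.sum_congr rfl fun z _ => mul_comm _ _

theorem blockSum_eq_sum_bra (b : OrthonormalBasis (Fin ℓ) ℂ (EuclideanSpace ℂ (Fin ℓ)))
    (A : Fin ℓ → Op (regDim d ℓ) (regME e)) :
    ResourceTheory.blockSum b A =
      ∑ j, (bra (splitLast d ℓ) b j)ᴴ * A j * bra (splitLast d ℓ) b j := by
  refine Finset.sum_congr rfl fun j _ => ?_
  ext v w
  obtain ⟨⟨x, z⟩, rfl⟩ := (splitLast d ℓ).surjective v
  obtain ⟨⟨y, w⟩, rfl⟩ := (splitLast d ℓ).surjective w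
  rw [bra_conjTranspose_mul_mul_bra_apply, tensor_splitLast]
  rfl

theorem tensor_one_eq_sum_bra (b : OrthonormalBasis (Fin ℓ) ℂ (EuclideanSpace ℂ (Fin ℓ)))
    (A : Op (regDim d ℓ) (regME e)) (r : ℂ) :
    tensor (Finset.subset_univ _) (Finset.subset_univ _) A
      (single (none : Option (Fin (e + 1))) (r • (1 : Matrix (Fin ℓ) (Fin ℓ) ℂ))) =
      r • ∑ j, (bra (splitLast d ℓ) b j)ᴴ * A * bra (splitLast d ℓ) b j := by
  ext v w
  obtain ⟨⟨x, z⟩, rfl⟩ := (splitLast d ℓ).surjective v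
  obtain ⟨⟨y, w⟩, rfl⟩ := (splitLast d ℓ).surjective w
  rw [Matrix.smul_apply, sum_conjTranspose_bra_mul_mul_apply]
  refine (tensor_splitLast A _ x y z w).trans ?_
  simp only [Matrix.smul_apply, one_apply, smul_eq_mul]
  ring

end Decomposition

section Tensor

variable {e : ℕ} {d : Fin (e + 1) → ℕ} {ℓ : ℕ}

theorem isState_tensor_single {ρ : Matrix (Fin (d 0)) (Fin (d 0)) ℂ}
    {μ : Op (regDim d ℓ) (regEJ e)} (hρ : IsState ρ) (hμ : IsState μ) :
    IsState (tensor (K := regM e) (L := Finset.univ) (Finset.subset_univ _)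
      (Finset.subset_univ _) (single (some 0) ρ) μ) := by
  constructor
  · have h := (hρ.1.kronecker hμ.1).submatrix (splitFirst d ℓ).symm
    refine (congrArg PosSemidef ?_).mpr h
    ext v w
    obtain ⟨⟨x, z⟩, rfl⟩ := (splitFirst d ℓ).surjective v
    obtain ⟨⟨y, w⟩, rfl⟩ := (splitFirst d ℓ).surjective w
    rw [tensor_splitFirst]
    simp [kroneckerMap_apply]
  · rw [← trace_partialTrace (splitFirst d ℓ), partialTrace_tensor_splitFirst, hμ.2, one_smul,
      hρ.2]

end Tensor

section Unitary

variable {n : Type*} [Fintype n] [DecidableEq n]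

theorem IsState.conj {X U : Matrix n n ℂ} (hX : IsState X) (hU : Uᴴ * U = 1) :
    IsState (U * X * Uᴴ) := by
  have := IsState.kraus (fun _ : Unit => U) (by simpa using hU) hX
  simpa using this

theorem purifiedDistance_conj_le {X Y U : Matrix n n ℂ} (hX : X.PosSemidef) (hY : Y.PosSemidef)
    (hU : Uᴴ * U = 1) : purifiedDistance (U * X * Uᴴ) (U * Y * Uᴴ) ≤ purifiedDistance X Y := by
  have := purifiedDistance_kraus_le (fun _ : Unit => U) (by simpa using hU) hX hY
  simpa using this

end Unitary

/-! ### The two converse bounds -/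

namespace ResourceTheory

variable {e : ℕ} {d : Fin (e + 1) → ℕ} {ℓ : ℕ} (T : ResourceTheory d ℓ)

theorem conj_mul_self_of_mem_freeOps {L : Finset (Option (Fin (e + 1)))}
    {U : Op (regDim d ℓ) L} (hU : U ∈ T.freeOps L) : Uᴴ * U = 1 ∧ U * Uᴴ = 1 :=
  ⟨mem_unitaryGroup_iff'.mp hU.1, mem_unitaryGroup_iff.mp hU.1⟩

theorem conjTranspose_mem_freeOps {L : Finset (Option (Fin (e + 1)))}
    {U : Op (regDim d ℓ) L} (hU : U ∈ T.freeOps L) : Uᴴ ∈ T.freeOps L := by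
  have h := T.conj_mul_self_of_mem_freeOps hU
  refine ⟨mem_unitaryGroup_iff.mpr ?_, fun σ hσ => ?_, fun σ hσ => ?_⟩
  · rw [star_eq_conjTranspose, conjTranspose_conjTranspose, h.1]
  · rw [conjTranspose_conjTranspose]; exact hU.2.2 σ hσ
  · rw [conjTranspose_conjTranspose]; exact hU.2.1 σ hσ

theorem tensor_maxMixed_mem {σ : Op (regDim d ℓ) (regME e)} (hσ : σ ∈ T.free (regME e)) :
    tensor (Finset.subset_univ _) (Finset.subset_univ _) σ
      (single (none : Option (Fin (e + 1))) ((ℓ : ℂ)⁻¹ • (1 : Matrix (Fin ℓ) (Fin ℓ) ℂ))) ∈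
      T.free Finset.univ :=
  T.tensor_mem (regME e) {none} Finset.univ _ _ ⟨some 0, by simp⟩ ⟨none, by simp⟩
    disjoint_regME_none regME_union_none σ hσ _ T.maxMixed_mem

/-- A state close to the output of a transformation and dominated by a multiple of the target
bounds the resource of the input. -/
theorem resourceDMax_le_of_posSemidef_sub {ε c : ℝ} (hc : 0 < c)
    {ρ : Matrix (Fin (d 0)) (Fin (d 0)) ℂ} (hρ : IsState ρ) {μ : Op (regDim d ℓ) (regEJ e)}
    {U : Op (regDim d ℓ) Finset.univ} {σ : Op (regDim d ℓ) (regME e)}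
    (hT : T.IsTransformation ε ρ μ U σ) {τ : Op (regDim d ℓ) Finset.univ} (hτ : IsState τ)
    (hP : purifiedDistance (U * tensor (K := regM e) (Finset.subset_univ _)
      (Finset.subset_univ _) (single (some 0) ρ) μ * Uᴴ) τ ≤ ε)
    (hdom : (c • tensor (Finset.subset_univ _) (Finset.subset_univ _) σ
      (single (none : Option (Fin (e + 1))) ((ℓ : ℂ)⁻¹ • (1 : Matrix (Fin ℓ) (Fin ℓ) ℂ))) -
        τ).PosSemidef) :
    resourceDMax ε ρ (T.freeSingle (some 0)) ≤ (Real.logb 2 c : EReal) := by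
  obtain ⟨hμ, hU, hσ, -⟩ := hT
  obtain ⟨hU1, hU2⟩ := T.conj_mul_self_of_mem_freeOps hU
  have hμs := T.isState _ ⟨none, by simp⟩ μ hμ
  have hX := isState_tensor_single hρ hμs
  set X := tensor (K := regM e) (L := Finset.univ) (Finset.subset_univ _) (Finset.subset_univ _)
    (single (some 0) ρ) μ with hXdef
  set ω := tensor (L := Finset.univ) (Finset.subset_univ _) (Finset.subset_univ _) σ
      (single (none : Option (Fin (e + 1))) ((ℓ : ℂ)⁻¹ • (1 : Matrix (Fin ℓ) (Fin ℓ) ℂ)))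
  -- Freeness of `Uᴴ` enters here: the pulled-back `σ ⊗ 1/ℓ` is free, and its marginal on `M` is the
  -- free state that is compared with `ρ`.
  have hω : Uᴴ * ω * U ∈ T.free Finset.univ := hU.2.2 ω (T.tensor_maxMixed_mem hσ)
  have hM := T.reduce_mem (regM e) Finset.univ ⟨some 0, by simp⟩ (Finset.subset_univ _) _ hω
  rw [reduce_regM] at hM
  have hUU : (Uᴴ)ᴴ * Uᴴ = 1 := by rwa [conjTranspose_conjTranspose]
  have hτ' : IsState (Uᴴ * τ * U) := by
    have := hτ.conj hUU
    rwa [conjTranspose_conjTranspose] at this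
  have hρX : partialTrace (splitFirst d ℓ) X = ρ := by
    rw [hXdef, partialTrace_tensor_splitFirst, hμs.2, one_smul]
  refine resourceDMax_le (σ := partialTrace (splitFirst d ℓ) (Uᴴ * ω * U))
    (ρ' := partialTrace (splitFirst d ℓ) (Uᴴ * τ * U)) hM
    ⟨posSemidef_partialTrace _ hτ'.1, by rw [trace_partialTrace, hτ'.2]⟩ ?_ ?_
  · have h1 := purifiedDistance_partialTrace_le (splitFirst d ℓ) hX.1 hτ'.1
    rw [hρX] at h1
    refine h1.trans (le_trans ?_ hP)
    have h2 := purifiedDistance_conj_le (hX.conj hU1).1 hτ.1 hUU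
    have h3 : Uᴴ * (U * X * Uᴴ) * (Uᴴ)ᴴ = X := by
      rw [conjTranspose_conjTranspose]
      calc Uᴴ * (U * X * Uᴴ) * U = (Uᴴ * U) * X * (Uᴴ * U) := by simp only [Matrix.mul_assoc]
        _ = X := by rw [hU1, Matrix.one_mul, Matrix.mul_one]
    rwa [h3, conjTranspose_conjTranspose] at h2
  · rw [Real.rpow_logb two_pos (by norm_num) hc, ← partialTrace_smul, ← partialTrace_sub]
    refine posSemidef_partialTrace _ ?_
    have := hdom.conjTranspose_mul_mul_same U
    rwa [Matrix.mul_sub, Matrix.sub_mul, Matrix.mul_smul, Matrix.smul_mul] at this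

/-- Uhlmann's theorem for the target of a transformation. -/
theorem exists_extension_of_isTransformation {ε : ℝ} (hℓ : 0 < ℓ)
    {ρ : Matrix (Fin (d 0)) (Fin (d 0)) ℂ} (hρ : IsState ρ) {μ : Op (regDim d ℓ) (regEJ e)}
    {U : Op (regDim d ℓ) Finset.univ} {σ : Op (regDim d ℓ) (regME e)}
    (hT : T.IsTransformation ε ρ μ U σ) :
    ∃ τ : Op (regDim d ℓ) Finset.univ, IsState τ ∧ partialTrace (splitLast d ℓ) τ = σ ∧
      purifiedDistance (U * tensor (K := regM e) (Finset.subset_univ _)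
        (Finset.subset_univ _) (single (some 0) ρ) μ * Uᴴ) τ ≤ ε := by
  obtain ⟨hμ, hU, hσ, hP⟩ := hT
  have hσs := T.isState _ ⟨some 0, by simp⟩ σ hσ
  have hX := (isState_tensor_single hρ (T.isState _ ⟨none, by simp⟩ μ hμ)).conj
    (T.conj_mul_self_of_mem_freeOps hU).1
  have : Nonempty (Fin ℓ) := ⟨⟨0, hℓ⟩⟩
  obtain ⟨τ, hτ, hτσ, hF⟩ := exists_extension (splitLast d ℓ) hX.1 hσs.1
  have hτσ' : partialTrace (splitLast d ℓ) τ = σ := hτσ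
  refine ⟨τ, ⟨hτ, by rw [← trace_partialTrace (splitLast d ℓ), hτσ', hσs.2]⟩, hτσ', ?_⟩
  rw [reduce_regME] at hP
  exact (purifiedDistance_le_of_fidelity_le hF).trans hP

/-- For an extension `τ` of `σ`, `τ ≤ ℓ · pinch τ ≤ ℓ · σ ⊗ 1 = ℓ² · σ ⊗ 1/ℓ`. Nothing makes the
output block diagonal here, so `τ` itself must be dominated. -/
theorem resourceDMax_le_of_isTransformation {ε : ℝ} (hℓ : 0 < ℓ)
    {ρ : Matrix (Fin (d 0)) (Fin (d 0)) ℂ} (hρ : IsState ρ) {μ : Op (regDim d ℓ) (regEJ e)}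
    {U : Op (regDim d ℓ) Finset.univ} {σ : Op (regDim d ℓ) (regME e)}
    (hT : T.IsTransformation ε ρ μ U σ) :
    resourceDMax ε ρ (T.freeSingle (some 0)) ≤ (Real.logb 2 ((ℓ : ℝ) ^ 2) : EReal) := by
  obtain ⟨τ, hτ, hτσ, hP⟩ := T.exists_extension_of_isTransformation hℓ hρ hT
  have hℓ' : (0 : ℝ) < ℓ := by exact_mod_cast hℓ
  refine T.resourceDMax_le_of_posSemidef_sub (by positivity) hρ hT hτ hP ?_
  let b := EuclideanSpace.basisFun (Fin ℓ) ℂ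
  rw [tensor_one_eq_sum_bra b]
  have h1 := posSemidef_sum_sub_pinching (bra (splitLast d ℓ) b) hτ.1
  rw [sum_bra_mul_mul, hτσ] at h1
  have h2 := posSemidef_card_smul_sum_sub
    (fun j => (bra (splitLast d ℓ) b j)ᴴ * bra (splitLast d ℓ) b j)
    (fun j => isHermitian_conjTranspose_mul_self _) (sum_conjTranspose_bra_mul_bra _ b) hτ.1
  rw [Fintype.card_fin] at h2
  have h3 := (h1.smul hℓ'.le).add h2
  convert h3 using 1
  have : ∀ Y : Op (regDim d ℓ) Finset.univ,
      ((ℓ : ℝ) ^ 2) • (ℓ : ℂ)⁻¹ • Y = (ℓ : ℝ) • Y := by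
    intro Y
    ext x y
    have hne : (ℓ : ℂ) ≠ 0 := by exact_mod_cast hℓ'.ne'
    simp only [Matrix.smul_apply, Complex.real_smul, smul_eq_mul]
    push_cast
    field_simp
  rw [this, smul_sub]
  abel

variable {T} {b : OrthonormalBasis (Fin ℓ) ℂ (EuclideanSpace ℂ (Fin ℓ))}

theorem bra_mul_blockSum (A : Fin ℓ → Op (regDim d ℓ) (regME e)) (i : Fin ℓ) :
    bra (splitLast d ℓ) b i * blockSum b A = A i * bra (splitLast d ℓ) b i := by
  rw [blockSum_eq_sum_bra, Matrix.mul_sum, Finset.sum_eq_single i]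
  · rw [← Matrix.mul_assoc, ← Matrix.mul_assoc, bra_mul_conjTranspose_bra, if_pos rfl,
      Matrix.one_mul]
  · intro j _ hj
    rw [← Matrix.mul_assoc, ← Matrix.mul_assoc, bra_mul_conjTranspose_bra, if_neg hj.symm,
      Matrix.zero_mul, Matrix.zero_mul]
  · simp

theorem conjTranspose_blockSum (A : Fin ℓ → Op (regDim d ℓ) (regME e)) :
    (blockSum b A)ᴴ = blockSum b fun j => (A j)ᴴ := by
  simp only [blockSum_eq_sum_bra, conjTranspose_sum, conjTranspose_mul,
    conjTranspose_conjTranspose, Matrix.mul_assoc]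

theorem blockSum_mul_blockSum (A B : Fin ℓ → Op (regDim d ℓ) (regME e)) :
    blockSum b A * blockSum b B = blockSum b fun j => A j * B j := by
  rw [blockSum_eq_sum_bra, blockSum_eq_sum_bra b fun j => A j * B j, Matrix.sum_mul]
  refine Finset.sum_congr rfl fun j _ => ?_
  rw [Matrix.mul_assoc, bra_mul_blockSum]
  simp only [Matrix.mul_assoc]

/-- The generators of the convex hull are block diagonal, and this is a linear condition. -/
theorem ClassicalRandomness.bra_mul_mul_bra_eq_zero (h : T.ClassicalRandomness b)
    {τ : Op (regDim d ℓ) Finset.univ} (hτ : τ ∈ T.free Finset.univ) {i j : Fin ℓ} (hij : i ≠ j) :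
    bra (splitLast d ℓ) b i * τ * (bra (splitLast d ℓ) b j)ᴴ = 0 := by
  rw [h.free_eq] at hτ
  let Z : Set (Op (regDim d ℓ) Finset.univ) :=
    {τ | bra (splitLast d ℓ) b i * τ * (bra (splitLast d ℓ) b j)ᴴ = 0}
  have hZ : Convex ℝ Z := by
    intro x hx y hy r s _ _ _
    have hx' : bra (splitLast d ℓ) b i * x * (bra (splitLast d ℓ) b j)ᴴ = 0 := hx
    have hy' : bra (splitLast d ℓ) b i * y * (bra (splitLast d ℓ) b j)ᴴ = 0 := hy
    change bra (splitLast d ℓ) b i * (r • x + s • y) * (bra (splitLast d ℓ) b j)ᴴ = 0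
    rw [Matrix.mul_add, Matrix.add_mul, Matrix.mul_smul, Matrix.mul_smul, Matrix.smul_mul,
      Matrix.smul_mul, hx', hy', smul_zero, smul_zero, add_zero]
  refine convexHull_min ?_ hZ hτ
  rintro _ ⟨σ, hσ, V, hV, rfl⟩
  change bra (splitLast d ℓ) b i * _ * (bra (splitLast d ℓ) b j)ᴴ = 0
  rw [Matrix.mul_smul, bra_mul_blockSum, Matrix.smul_mul, Matrix.mul_assoc,
    bra_mul_conjTranspose_bra, if_neg hij, Matrix.mul_zero, smul_zero]

theorem splitLast_apply_some (p : Idx (regDim d ℓ) (regME e) × Fin ℓ) (i : Fin (e + 1))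
    (hi : some i ∈ Finset.univ) :
    splitLast d ℓ p ⟨some i, hi⟩ = p.1 ⟨some i, by simp⟩ := by
  simp [splitLast, joinSingle, joinIdx]

theorem splitLast_apply_none (p : Idx (regDim d ℓ) (regME e) × Fin ℓ)
    (hi : none ∈ Finset.univ) :
    splitLast d ℓ p ⟨none, hi⟩ = p.2 := by
  simp [splitLast, joinSingle, joinIdx, singleIdx]

/-- Whether an operator on all but the first register is block diagonal can be tested after
tensoring it with any state of the first register. -/
theorem bra_mul_tensor_mul_bra_eq_zero {s : Matrix (Fin (d 0)) (Fin (d 0)) ℂ} (hs : IsState s)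
    {μ : Op (regDim d ℓ) (regEJ e)} {i j : Fin ℓ}
    (h : bra (splitLast d ℓ) b i * tensor (K := regM e) (Finset.subset_univ _)
      (Finset.subset_univ _) (single (some 0) s) μ * (bra (splitLast d ℓ) b j)ᴴ = 0)
    (ρ : Matrix (Fin (d 0)) (Fin (d 0)) ℂ) :
    bra (splitLast d ℓ) b i * tensor (K := regM e) (Finset.subset_univ _)
      (Finset.subset_univ _) (single (some 0) ρ) μ * (bra (splitLast d ℓ) b j)ᴴ = 0 := by
  -- Each entry of the block is an entry of the operator on `M` times `m`, and `m` ignores the `M`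
  -- coordinate. Setting that coordinate to `p`, with `s p p ≠ 0`, isolates `m`.
  let m : Idx (regDim d ℓ) (regME e) → Idx (regDim d ℓ) (regME e) → ℂ := fun x y =>
    ∑ z, ∑ w, star (b i z) *
      μ (restrictIdx (Finset.subset_univ _) (splitLast d ℓ (x, z)))
        (restrictIdx (Finset.subset_univ _) (splitLast d ℓ (y, w))) * b j w
  have hm : ∀ (A : Matrix (Fin (d 0)) (Fin (d 0)) ℂ) x y,
      (bra (splitLast d ℓ) b i * tensor (K := regM e) (Finset.subset_univ _)
        (Finset.subset_univ _) (single (some 0) A) μ * (bra (splitLast d ℓ) b j)ᴴ) x y =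
      A (x ⟨some 0, by simp⟩) (y ⟨some 0, by simp⟩) * m x y := by
    intro A x y
    rw [bra_mul_mul_bra_apply, Finset.mul_sum]
    refine Finset.sum_congr rfl fun z _ => ?_
    rw [Finset.mul_sum]
    refine Finset.sum_congr rfl fun w _ => ?_
    simp only [tensor, of_apply, single, submatrix_apply, restrictIdx, splitLast_apply_some]
    ring
  obtain ⟨p, hp⟩ : ∃ p, s p p ≠ 0 := by
    by_contra hcon
    push Not at hcon
    have := hs.2
    simp [trace, hcon] at this
  have hupd : ∀ (x : Idx (regDim d ℓ) (regME e)) z,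
      restrictIdx (Finset.subset_univ (regEJ e))
        (splitLast d ℓ (Function.update x ⟨some 0, by simp⟩ p, z)) =
      restrictIdx (Finset.subset_univ (regEJ e)) (splitLast d ℓ (x, z)) := by
    intro x z
    funext ⟨k, hk⟩
    cases k with
    | none => simp only [restrictIdx, splitLast_apply_none]
    | some k =>
      have hk0 : k ≠ 0 := by rintro rfl; simp at hk
      simp only [restrictIdx, splitLast_apply_some]
      rw [Function.update_of_ne]
      simpa using hk0
  have hm0 : ∀ x y, m x y = 0 := by
    intro x y
    have h1 := hm s (Function.update x ⟨some 0, by simp⟩ p) (Function.update y ⟨some 0, by simp⟩ p)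
    rw [h] at h1
    simp only [Matrix.zero_apply, Function.update_self, m, hupd] at h1
    exact (mul_eq_zero.mp h1.symm).resolve_left hp
  ext x y
  rw [hm, hm0, mul_zero, Matrix.zero_apply]

/-- The output is block diagonal, so pinching `τ` keeps it within `ε` of the output. The pinched `τ`
lies below `σ ⊗ 1 = ℓ · σ ⊗ 1/ℓ`, with no loss from the pinching inequality. -/
theorem ClassicalRandomness.resourceDMax_le (h : T.ClassicalRandomness b) {ε : ℝ} (hℓ : 0 < ℓ)
    {ρ : Matrix (Fin (d 0)) (Fin (d 0)) ℂ} (hρ : IsState ρ) {μ : Op (regDim d ℓ) (regEJ e)}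
    {U : Op (regDim d ℓ) Finset.univ} {σ : Op (regDim d ℓ) (regME e)}
    (hT : T.IsTransformation ε ρ μ U σ) (hU : U ∈ T.controlledOps b) :
    resourceDMax ε ρ (T.freeSingle (some 0)) ≤ (Real.logb 2 ℓ : EReal) := by
  obtain ⟨τ, hτ, hτσ, hP⟩ := T.exists_extension_of_isTransformation hℓ hρ hT
  have hℓ' : (0 : ℝ) < ℓ := by exact_mod_cast hℓ
  have hμs := T.isState _ ⟨none, by simp⟩ μ hT.1
  have hUf := T.conj_mul_self_of_mem_freeOps hT.2.1
  obtain ⟨V, hV, rfl⟩ := hU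
  let K := bra (splitLast d ℓ) b
  have hK1 : ∑ j, (K j)ᴴ * K j = 1 := sum_conjTranspose_bra_mul_bra _ b
  have hKK : ∀ j, (K j)ᴴ * K j * ((K j)ᴴ * K j) = (K j)ᴴ * K j := by
    intro j
    rw [Matrix.mul_assoc, ← Matrix.mul_assoc (K j) _ (K j), bra_mul_conjTranspose_bra,
      if_pos rfl, Matrix.one_mul]
  have hPh : ∀ j, ((K j)ᴴ * K j)ᴴ = (K j)ᴴ * K j := fun j =>
    isHermitian_conjTranspose_mul_self _
  have hpin : ∑ j, ((K j)ᴴ * K j)ᴴ * ((K j)ᴴ * K j) = 1 := by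
    simp only [hPh, hKK, hK1]
  have hX := (isState_tensor_single hρ hμs).conj hUf.1
  have hblock : ∀ i j, i ≠ j → K i * tensor (K := regM e) (Finset.subset_univ _)
      (Finset.subset_univ _) (single (some 0) ρ) μ * (K j)ᴴ = 0 := by
    intro i j hij
    -- `ρ` need not be free, so block diagonality is read off from a free state `s ⊗ μ`; the
    -- marginal of the target on `M` supplies a free `s`.
    have hσM := T.reduce_mem (regM e) (regME e) ⟨some 0, by simp⟩ (by simp [regM]) σ hT.2.2.1
    rw [← single_submatrix_singleIdx (d := regDim d ℓ) (some 0) (reduce (regM e) σ)] at hσM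
    have hs := (isState_single_iff _ _).mp (T.isState _ ⟨some 0, by simp⟩ _ hσM)
    refine bra_mul_tensor_mul_bra_eq_zero hs (h.bra_mul_mul_bra_eq_zero ?_ hij) ρ
    exact T.tensor_mem (regM e) (regEJ e) Finset.univ _ _ ⟨some 0, by simp⟩ ⟨none, by simp⟩
      disjoint_regM_regEJ regM_union_regEJ _ hσM μ hT.1
  set X := tensor (K := regM e) (L := Finset.univ) (Finset.subset_univ _) (Finset.subset_univ _)
    (single (some 0) ρ) μ
  -- A controlled unitary maps the `(i, j)` block to `V i (·) (V j)ᴴ`, so vanishing off-diagonal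
  -- blocks stay zero.
  have hXpin : ∑ j, ((K j)ᴴ * K j) * (blockSum b V * X * (blockSum b V)ᴴ) * ((K j)ᴴ * K j)ᴴ =
      blockSum b V * X * (blockSum b V)ᴴ := by
    set Θ := blockSum b V * X * (blockSum b V)ᴴ with hΘ
    have hΘij : ∀ i j, i ≠ j → ((K i)ᴴ * K i) * Θ * ((K j)ᴴ * K j) = 0 := by
      intro i j hij
      have h1 : K i * Θ * (K j)ᴴ = V i * (K i * X * (K j)ᴴ) * (V j)ᴴ := by
        have e1 := bra_mul_blockSum (b := b) V i
        have e2 := congrArg conjTranspose (bra_mul_blockSum (b := b) V j)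
        rw [conjTranspose_mul, conjTranspose_mul] at e2
        calc K i * Θ * (K j)ᴴ = (K i * blockSum b V) * X * ((blockSum b V)ᴴ * (K j)ᴴ) := by
              simp only [hΘ, Matrix.mul_assoc]
          _ = (V i * K i) * X * ((K j)ᴴ * (V j)ᴴ) := by rw [e1, e2]
          _ = _ := by simp only [Matrix.mul_assoc]
      calc ((K i)ᴴ * K i) * Θ * ((K j)ᴴ * K j) = (K i)ᴴ * (K i * Θ * (K j)ᴴ) * K j := by
            simp only [Matrix.mul_assoc]
        _ = 0 := by
          rw [h1, hblock i j hij, Matrix.mul_zero, Matrix.zero_mul, Matrix.mul_zero,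
            Matrix.zero_mul]
    have h2 : ∀ i, ((K i)ᴴ * K i) * Θ * ((K i)ᴴ * K i) = ((K i)ᴴ * K i) * Θ := by
      intro i
      have : ((K i)ᴴ * K i) * Θ = ∑ j, ((K i)ᴴ * K i) * Θ * ((K j)ᴴ * K j) := by
        rw [← Matrix.mul_sum, hK1, Matrix.mul_one]
      refine Eq.symm (this.trans (Finset.sum_eq_single i ?_ ?_))
      · intro j _ hj; exact hΘij i j hj.symm
      · simp
    simp only [hPh, h2]
    rw [← Matrix.sum_mul, hK1, Matrix.one_mul]
  have hτ' := IsState.kraus (fun j => (K j)ᴴ * K j) hpin hτ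
  have hP' := purifiedDistance_kraus_le (fun j => (K j)ᴴ * K j) hpin hX.1 hτ.1
  rw [hXpin] at hP'
  refine T.resourceDMax_le_of_posSemidef_sub hℓ' hρ hT hτ' (hP'.trans hP) ?_
  rw [tensor_one_eq_sum_bra b]
  have h1 := posSemidef_sum_sub_pinching K hτ.1
  have h2 : ∑ i, K i * τ * (K i)ᴴ = σ := by rw [sum_bra_mul_mul, hτσ]
  rw [h2] at h1
  have : ∀ Y : Op (regDim d ℓ) Finset.univ, (ℓ : ℝ) • (ℓ : ℂ)⁻¹ • Y = Y := by
    intro Y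
    ext x y
    have hne : (ℓ : ℂ) ≠ 0 := by exact_mod_cast hℓ'.ne'
    simp only [Matrix.smul_apply, Complex.real_smul, smul_eq_mul]
    push_cast
    field_simp
  rw [this]
  simpa only [hPh] using h1

end ResourceTheory

/-! ### Product operators on groups of registers -/

section ProductOperators

variable {I : Type*} [DecidableEq I] {d : I → ℕ}

/-- The tensor product over the registers `L` of a family of operators on single registers. -/
def prodOp (A : (i : I) → Matrix (Fin (d i)) (Fin (d i)) ℂ) (L : Finset I) : Op d L :=
  of fun x y => ∏ i : L, A i (x i) (y i)

theorem prodOp_congr {A B : (i : I) → Matrix (Fin (d i)) (Fin (d i)) ℂ} {L : Finset I}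
    (h : ∀ i ∈ L, A i = B i) : prodOp A L = prodOp B L := by
  ext x y
  exact Finset.prod_congr rfl fun i _ => by rw [h i i.2]

theorem tensor_prodOp (A : (i : I) → Matrix (Fin (d i)) (Fin (d i)) ℂ) {K K' L : Finset I}
    (hK : K ⊆ L) (hK' : K' ⊆ L) (hd : Disjoint K K') (hu : K ∪ K' = L) :
    tensor hK hK' (prodOp A K) (prodOp A K') = prodOp A L := by
  ext x y
  let g : I → ℂ := fun i => if h : i ∈ L then A i (x ⟨i, h⟩) (y ⟨i, h⟩) else 1
  have hg : ∀ {N : Finset I} (hN : N ⊆ L),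
      prodOp A N (restrictIdx hN x) (restrictIdx hN y) = ∏ i ∈ N, g i := by
    intro N hN
    rw [← Finset.prod_coe_sort]
    refine Finset.prod_congr rfl fun i _ => ?_
    simp only [g, dif_pos (hN i.2), restrictIdx]
  have h1 : prodOp A L x y = ∏ i ∈ L, g i := hg (Finset.Subset.refl L)
  simp only [tensor, of_apply, hg]
  rw [h1, ← hu, Finset.prod_union hd]

theorem prodOp_singleton (A : (i : I) → Matrix (Fin (d i)) (Fin (d i)) ℂ) (i : I) :
    prodOp A {i} = single i (A i) := by
  ext x y
  simp only [prodOp, of_apply]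
  have : Subsingleton ({i} : Finset I) := ⟨fun a b => Subtype.ext
    ((Finset.mem_singleton.mp a.2).trans (Finset.mem_singleton.mp b.2).symm)⟩
  exact Fintype.prod_subsingleton (fun k : ({i} : Finset I) => A k (x k) (y k))
    ⟨i, Finset.mem_singleton_self i⟩

/-- Needed for a single copy, when `E` has no registers: the axioms say nothing about the empty set
of registers. -/
theorem isState_prodOp_empty (A : (i : I) → Matrix (Fin (d i)) (Fin (d i)) ℂ) :
    IsState (prodOp A ∅) := by
  have : prodOp A (∅ : Finset I) = 1 := by
    ext x y
    obtain rfl := Subsingleton.elim x y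
    simp [prodOp]
  rw [this]
  exact ⟨PosSemidef.one, by simp⟩

end ProductOperators

/-! ### Relabelling the basis as a unitary -/

section Reindex

variable {m n : Type*} [Fintype m] [DecidableEq m] [Fintype n] [DecidableEq n]

/-- The unitary that relabels the basis. -/
theorem one_submatrix_mul_mul (φ : m ≃ n) (X : Matrix n n ℂ) :
    (1 : Matrix n n ℂ).submatrix φ id * X * ((1 : Matrix n n ℂ).submatrix φ id)ᴴ =
      X.submatrix φ φ := by
  ext x y
  simp [mul_apply, one_apply]

theorem one_submatrix_conjTranspose_mul_mul (φ : m ≃ n) (X : Matrix m m ℂ) :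
    ((1 : Matrix n n ℂ).submatrix φ id)ᴴ * X * (1 : Matrix n n ℂ).submatrix φ id =
      X.submatrix φ.symm φ.symm := by
  have h : ((1 : Matrix n n ℂ).submatrix φ id)ᴴ = (1 : Matrix m m ℂ).submatrix φ.symm id := by
    ext x y
    simp [one_apply, Equiv.symm_apply_eq, eq_comm (a := φ y)]
  have h' := one_submatrix_mul_mul φ.symm X
  rwa [← h, conjTranspose_conjTranspose] at h'

theorem one_submatrix_conjTranspose_mul_self (φ : m ≃ n) :
    ((1 : Matrix n n ℂ).submatrix φ id)ᴴ * (1 : Matrix n n ℂ).submatrix φ id = 1 := by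
  have := one_submatrix_conjTranspose_mul_mul φ (1 : Matrix m m ℂ)
  rwa [Matrix.mul_one, submatrix_one_equiv] at this

theorem purifiedDistance_submatrix_le (φ : m ≃ n) {ρ σ : Matrix n n ℂ} (hρ : ρ.PosSemidef)
    (hσ : σ.PosSemidef) :
    purifiedDistance (ρ.submatrix φ φ) (σ.submatrix φ φ) ≤ purifiedDistance ρ σ := by
  have := purifiedDistance_kraus_le (fun _ : Unit => (1 : Matrix n n ℂ).submatrix φ id)
    (by simp) hρ hσ
  simpa only [Finset.univ_unique, Finset.sum_singleton, one_submatrix_mul_mul] using this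

end Reindex

/-! ### Several copies of one system and their permutations -/

section Copies

variable {e D ℓ : ℕ}

/-- A family of operators on the single registers. -/
def regFamily (B : Fin (e + 1) → Matrix (Fin D) (Fin D) ℂ) (C : Matrix (Fin ℓ) (Fin ℓ) ℂ) :
    (i : Option (Fin (e + 1))) → Matrix (Fin (regDim (fun _ : Fin (e + 1) => D) ℓ i))
      (Fin (regDim (fun _ : Fin (e + 1) => D) ℓ i)) ℂ
  | none => C
  | some i => B i

/-- The basis of `e + 1` copies of a system. -/
def copiesIdx (e D ℓ : ℕ) :
    Idx (regDim (fun _ : Fin (e + 1) => D) ℓ) (regME e) ≃ (Fin (e + 1) → Fin D) where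
  toFun x i := x ⟨some i, by simp⟩
  invFun y
    | ⟨none, h⟩ => absurd h (by simp)
    | ⟨some i, _⟩ => y i
  left_inv x := by
    funext ⟨i, hi⟩
    cases i with
    | none => simp at hi
    | some i => rfl
  right_inv y := rfl

theorem prodOp_regFamily_regME (B : Fin (e + 1) → Matrix (Fin D) (Fin D) ℂ)
    (C : Matrix (Fin ℓ) (Fin ℓ) ℂ) :
    prodOp (regFamily B C) (regME e) =
      (piTensor B).submatrix (copiesIdx e D ℓ) (copiesIdx e D ℓ) := by
  let φ : Fin (e + 1) ≃ regME e :=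
    Equiv.ofBijective (fun i => ⟨some i, by simp⟩) ⟨fun i j h => by simpa using h, by
      rintro ⟨i, hi⟩
      cases i with
      | none => simp at hi
      | some i => exact ⟨i, rfl⟩⟩
  ext x y
  exact (φ.prod_comp fun i => regFamily B C i (x i) (y i)).symm

/-- Permutation of the copies. -/
def permuteCopies (e D ℓ : ℕ) (π : Equiv.Perm (Fin (e + 1))) :
    Idx (regDim (fun _ : Fin (e + 1) => D) ℓ) (regME e) ≃
      Idx (regDim (fun _ : Fin (e + 1) => D) ℓ) (regME e) :=
  (copiesIdx e D ℓ).trans ((π.symm.arrowCongr (Equiv.refl _)).trans (copiesIdx e D ℓ).symm)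

/-- `permuteCopies` precomposes the coordinates with `π`, so the order of composition reverses. -/
theorem permuteCopies_permuteCopies (π π' : Equiv.Perm (Fin (e + 1)))
    (x : Idx (regDim (fun _ : Fin (e + 1) => D) ℓ) (regME e)) :
    permuteCopies e D ℓ π (permuteCopies e D ℓ π' x) = permuteCopies e D ℓ (π' * π) x := by
  funext ⟨i, hi⟩
  cases i with
  | none => simp at hi
  | some i => rfl

theorem permuteCopies_symm (π : Equiv.Perm (Fin (e + 1))) :
    (permuteCopies e D ℓ π).symm = permuteCopies e D ℓ π⁻¹ := by
  ext x : 1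
  rw [Equiv.symm_apply_eq, permuteCopies_permuteCopies, inv_mul_cancel]
  funext ⟨i, hi⟩
  cases i with
  | none => simp at hi
  | some i => rfl

theorem prodOp_submatrix_permuteCopies (B : Fin (e + 1) → Matrix (Fin D) (Fin D) ℂ)
    (C : Matrix (Fin ℓ) (Fin ℓ) ℂ) (π : Equiv.Perm (Fin (e + 1))) :
    (prodOp (regFamily B C) (regME e)).submatrix (permuteCopies e D ℓ π)
      (permuteCopies e D ℓ π) = prodOp (regFamily (fun i => B (π⁻¹ i)) C) (regME e) := by
  rw [prodOp_regFamily_regME, prodOp_regFamily_regME]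
  ext x y
  simp only [submatrix_apply, piTensor, of_apply]
  refine Eq.trans (Finset.prod_congr rfl fun i _ => ?_) (Equiv.prod_comp π _)
  rw [show π⁻¹ (π i) = i from π.symm_apply_apply i]
  rfl

end Copies

/-! ### Free permutations and the achievability protocol -/

namespace ResourceTheory

section

variable {e : ℕ} {d : Fin (e + 1) → ℕ} {ℓ : ℕ} {T : ResourceTheory d ℓ}
  {b : OrthonormalBasis (Fin ℓ) ℂ (EuclideanSpace ℂ (Fin ℓ))}

theorem prodOp_mem_free (A : (i : Option (Fin (e + 1))) → Matrix (Fin (regDim d ℓ i))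
      (Fin (regDim d ℓ i)) ℂ) (hA : ∀ i, A i ∈ T.freeSingle i)
    {L : Finset (Option (Fin (e + 1)))} (hL : L.Nonempty) : prodOp A L ∈ T.free L := by
  induction hL using Finset.Nonempty.cons_induction with
  | singleton i => rw [prodOp_singleton]; exact hA i
  | cons i s hi hs ih =>
    have hu : {i} ∪ s = Finset.cons i s hi := by rw [Finset.cons_eq_insert]; rfl
    have hd : Disjoint {i} s := by simpa using hi
    rw [← tensor_prodOp A (K := {i}) (K' := s) (by simp) (by simp) hd hu]
    refine T.tensor_mem _ _ _ _ _ (by simp) hs hd hu _ ?_ _ ih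
    rw [prodOp_singleton]; exact hA i

theorem blockSum_one : blockSum (d := d) b (fun _ => 1) = 1 := by
  simp only [blockSum_eq_sum_bra, Matrix.mul_one]
  exact sum_conjTranspose_bra_mul_bra _ b

/-- Controlled free operations are free. -/
theorem ClassicalRandomness.blockSum_mem_freeOps (h : T.ClassicalRandomness b)
    {V : Fin ℓ → Op (regDim d ℓ) (regME e)} (hV : ∀ j, V j ∈ T.freeOps (regME e)) :
    blockSum b V ∈ T.freeOps Finset.univ := by
  have key : ∀ W : Fin ℓ → Op (regDim d ℓ) (regME e), (∀ j, W j ∈ T.freeOps (regME e)) →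
      ∀ τ ∈ T.free Finset.univ, blockSum b W * τ * (blockSum b W)ᴴ ∈ T.free Finset.univ := by
    intro W hW τ hτ
    rw [h.free_eq] at hτ
    -- Convexity reduces the claim to the generators, whose controlled unitaries `V'` are merely
    -- replaced by the products `W j * V' j`.
    let Z : Set (Op (regDim d ℓ) Finset.univ) :=
      {τ | blockSum b W * τ * (blockSum b W)ᴴ ∈ T.free Finset.univ}
    have hZ : Convex ℝ Z := by
      intro x hx y hy r s hr hs hrs
      change blockSum b W * (r • x + s • y) * (blockSum b W)ᴴ ∈ T.free Finset.univ
      rw [Matrix.mul_add, Matrix.add_mul, Matrix.mul_smul, Matrix.mul_smul, Matrix.smul_mul,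
        Matrix.smul_mul]
      exact T.convex _ ⟨none, Finset.mem_univ _⟩ hx hy hr hs hrs
    refine convexHull_min ?_ hZ hτ
    rintro _ ⟨σ, hσ, V', hV', rfl⟩
    change blockSum b W * _ * (blockSum b W)ᴴ ∈ T.free Finset.univ
    rw [h.free_eq]
    refine subset_convexHull ℝ _ ⟨σ, hσ, fun j => W j * V' j, fun j => ?_, ?_⟩
    · have h1 := (hW j).2
      have h2 := (hV' j).2
      refine ⟨mul_mem (hW j).1 (hV' j).1, fun s hs => ?_, fun s hs => ?_⟩
      · have := h1.1 _ (h2.1 s hs)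
        simpa only [conjTranspose_mul, Matrix.mul_assoc] using this
      · have := h2.2 _ (h1.2 s hs)
        simpa only [conjTranspose_mul, Matrix.mul_assoc] using this
    · rw [Matrix.mul_smul, Matrix.smul_mul, conjTranspose_blockSum, blockSum_mul_blockSum,
        blockSum_mul_blockSum]
      simp only [conjTranspose_mul, Matrix.mul_assoc]
  refine ⟨mem_unitaryGroup_iff.mpr ?_, key V hV, fun τ hτ => ?_⟩
  · rw [star_eq_conjTranspose, conjTranspose_blockSum, blockSum_mul_blockSum]
    simp only [(T.conj_mul_self_of_mem_freeOps (hV _)).2, blockSum_one]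
  · have := key _ (fun j => T.conjTranspose_mem_freeOps (hV j)) τ hτ
    rwa [← conjTranspose_blockSum, conjTranspose_conjTranspose] at this

theorem partialTrace_blockSum (A : Fin ℓ → Op (regDim d ℓ) (regME e)) :
    partialTrace (splitLast d ℓ) (blockSum b A) = ∑ j, A j := by
  rw [← sum_bra_mul_mul _ b]
  refine Finset.sum_congr rfl fun j _ => ?_
  rw [bra_mul_blockSum, Matrix.mul_assoc, bra_mul_conjTranspose_bra, if_pos rfl, Matrix.mul_one]

end

section Achievability

variable {e D ℓ : ℕ} {T : ResourceTheory (fun _ : Fin (e + 1) => D) ℓ}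
  {b : OrthonormalBasis (Fin ℓ) ℂ (EuclideanSpace ℂ (Fin ℓ))}
  {F : Set (Matrix (Fin D) (Fin D) ℂ)}

theorem toFront_splitLast (j : Fin (e + 1))
    (x : Idx (regDim (fun _ : Fin (e + 1) => D) ℓ) (regME e)) (z : Fin ℓ) :
    toFront (fun _ => rfl) j (splitLast (fun _ : Fin (e + 1) => D) ℓ (x, z)) =
      splitLast (fun _ : Fin (e + 1) => D) ℓ (permuteCopies e D ℓ j.cycleRange x, z) := by
  funext ⟨i, hi⟩
  cases i with
  | none =>
    rw [splitLast_apply_none]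
    exact splitLast_apply_none _ _
  | some i =>
    rw [splitLast_apply_some]
    exact splitLast_apply_some (x, z) (j.cycleRange i) (Finset.mem_univ _)

/-- The permutation axiom concerns the whole system: append the maximally mixed state on `J`, move
register `j` to the front, and discard `J`. -/
theorem ClassicalRandomness.submatrix_permuteCopies_cycleRange_mem
    (h : T.ClassicalRandomness b) (hℓ : 0 < ℓ) (hF : ∀ i, T.freeSingle (some i) = F)
    (j : Fin (e + 1)) {τ : Op (regDim (fun _ : Fin (e + 1) => D) ℓ) (regME e)}
    (hτ : τ ∈ T.free (regME e)) :
    τ.submatrix (permuteCopies e D ℓ j.cycleRange) (permuteCopies e D ℓ j.cycleRange) ∈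
      T.free (regME e) := by
  have h1 := h.permute (fun _ => rfl) (fun i σ => by
    have e1 : σ ∈ T.freeSingle (some 0) ↔ σ ∈ F := by rw [hF 0]
    have e2 : σ ∈ T.freeSingle (some i) ↔ σ ∈ F := by rw [hF i]
    exact e1.trans e2.symm) j _ (T.tensor_maxMixed_mem hτ)
  have h2 := T.reduce_mem (regME e) _ ⟨some 0, by simp⟩ (Finset.subset_univ _) _ h1
  rw [reduce_regME] at h2
  convert h2 using 1
  ext x y
  have hℓ' : (ℓ : ℂ) ≠ 0 := by exact_mod_cast hℓ.ne'
  simp only [partialTrace, of_apply, submatrix_apply, toFront_splitLast]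
  have : ∀ z : Fin ℓ, tensor (Finset.subset_univ _) (Finset.subset_univ _) τ
      (single (none : Option (Fin (e + 1))) ((ℓ : ℂ)⁻¹ • (1 : Matrix (Fin ℓ) (Fin ℓ) ℂ)))
      (splitLast (fun _ : Fin (e + 1) => D) ℓ (permuteCopies e D ℓ j.cycleRange x, z))
      (splitLast (fun _ : Fin (e + 1) => D) ℓ (permuteCopies e D ℓ j.cycleRange y, z)) =
      τ (permuteCopies e D ℓ j.cycleRange x) (permuteCopies e D ℓ j.cycleRange y) *
        (ℓ : ℂ)⁻¹ := by
    intro z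
    refine (tensor_splitLast τ _ _ _ z z).trans ?_
    simp
  simp only [this]
  simp only [Finset.sum_const, Finset.card_univ, Fintype.card_fin, nsmul_eq_mul]
  field_simp

/-- A free operation must preserve free states in both directions, whereas the axiom only moves a
register to the front. The cycle has finite order, so its inverse is one of its powers. -/
theorem ClassicalRandomness.permute_mem_freeOps
    (h : T.ClassicalRandomness b) (hℓ : 0 < ℓ) (hF : ∀ i, T.freeSingle (some i) = F)
    (j : Fin (e + 1)) :
    (1 : Op (regDim (fun _ : Fin (e + 1) => D) ℓ) (regME e)).submatrix
      (permuteCopies e D ℓ (j.cycleRange)⁻¹) id ∈ T.freeOps (regME e) := by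
  have hpow : ∀ (k : ℕ), ∀ τ ∈ T.free (regME e),
      τ.submatrix (permuteCopies e D ℓ (j.cycleRange ^ k))
        (permuteCopies e D ℓ (j.cycleRange ^ k)) ∈ T.free (regME e) := by
    intro k
    induction k with
    | zero =>
      intro τ hτ
      have : ⇑(permuteCopies e D ℓ (j.cycleRange ^ 0)) = id := by
        funext x ⟨i, hi⟩
        cases i with
        | none => simp at hi
        | some i => rfl
      rwa [this, submatrix_id_id]
    | succ k ih =>
      intro τ hτ
      have := h.submatrix_permuteCopies_cycleRange_mem hℓ hF j (ih τ hτ)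
      rw [submatrix_submatrix] at this
      have e1 : ⇑(permuteCopies e D ℓ (j.cycleRange ^ k)) ∘
          ⇑(permuteCopies e D ℓ j.cycleRange) = permuteCopies e D ℓ (j.cycleRange ^ (k + 1)) := by
        funext x
        rw [Function.comp_apply, permuteCopies_permuteCopies, pow_succ']
      rwa [e1] at this
  have hinv : (j.cycleRange)⁻¹ = j.cycleRange ^ (orderOf j.cycleRange - 1) := by
    symm
    apply eq_inv_of_mul_eq_one_left
    rw [← pow_succ, Nat.sub_add_cancel (orderOf_pos _), pow_orderOf_eq_one]
  refine ⟨mem_unitaryGroup_iff'.mpr (one_submatrix_conjTranspose_mul_self _),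
    fun τ hτ => ?_, fun τ hτ => ?_⟩
  · rw [one_submatrix_mul_mul, hinv]
    exact hpow _ τ hτ
  · rw [one_submatrix_conjTranspose_mul_mul, permuteCopies_symm, inv_inv]
    have := hpow 1 τ hτ
    rwa [pow_one] at this

end Achievability

section

variable {e D : ℕ} {T : ResourceTheory (fun _ : Fin (e + 1) => D) (e + 1)}
  {b : OrthonormalBasis (Fin (e + 1)) ℂ (EuclideanSpace ℂ (Fin (e + 1)))}
  {F : Set (Matrix (Fin D) (Fin D) ℂ)}

/-- The protocol takes as many copies as `J` has dimensions. The ancilla is `σ^{⊗e}` with a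
maximally mixed `J`, the target is `σ^{⊗(e+1)}`, and the state left on `ME` is the convex split; the
catalyst `σ^{⊗e}` returns as a factor of the target. -/
theorem ClassicalRandomness.exists_isCatalyticTransformation
    (h : T.ClassicalRandomness b) (hF : ∀ i, T.freeSingle (some i) = F)
    {ρ ρ' σ : Matrix (Fin D) (Fin D) ℂ} (hρ : IsState ρ) (hρ' : IsState ρ') (hσF : σ ∈ F)
    {K ε δ : ℝ} (hε : 0 ≤ ε) (hδ : 0 < δ) (hP : purifiedDistance ρ ρ' ≤ ε)
    (hK : (K • σ - ρ').PosSemidef) (hcard : K / δ ^ 2 < (e + 1 : ℕ) + 1) :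
    ∃ μ U τ, T.IsCatalyticTransformation (ε + δ) ρ μ U τ ∧ U ∈ T.controlledOps b := by
  have hσs : IsState σ := by
    have h0 : σ ∈ T.freeSingle (some 0) := by rw [hF 0]; exact hσF
    exact (isState_single_iff (d := regDim (fun _ : Fin (e + 1) => D) (e + 1)) (some 0) σ).mp
      (T.isState _ ⟨some 0, by simp⟩ _ h0)
  let C : Matrix (Fin (e + 1)) (Fin (e + 1)) ℂ := (((e + 1 : ℕ) : ℂ))⁻¹ • 1
  let A := regFamily (fun _ : Fin (e + 1) => σ) C
  let A' := regFamily (Function.update (fun _ : Fin (e + 1) => σ) 0 ρ) C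
  have hA : ∀ i, A i ∈ T.freeSingle i := by
    intro i
    cases i with
    | none => exact T.maxMixed_mem
    | some i => rw [hF i]; exact hσF
  -- `cycleRange` sends `j` to `0`; conjugation by the relabelling with its inverse carries `ρ` from
  -- the first place to place `j`.
  let V : Fin (e + 1) → Op (regDim (fun _ : Fin (e + 1) => D) (e + 1)) (regME e) := fun j =>
    (1 : Op (regDim (fun _ : Fin (e + 1) => D) (e + 1)) (regME e)).submatrix
      (permuteCopies e D (e + 1) (j.cycleRange)⁻¹) id
  have hV : ∀ j, V j ∈ T.freeOps (regME e) := fun j =>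
    h.permute_mem_freeOps (Nat.succ_pos e) hF j
  -- The maximally mixed state is diagonal in every basis, so the input is a block sum in the
  -- prescribed basis, with equal blocks.
  have hX : tensor (K := regM e) (L := Finset.univ) (Finset.subset_univ _)
      (Finset.subset_univ _) (single (some 0) ρ) (prodOp A (regEJ e)) =
      ((e + 1 : ℕ) : ℂ)⁻¹ • blockSum b fun _ => prodOp A' (regME e) := by
    have e1 : single (some 0) ρ = prodOp A' (regM e) := by
      rw [prodOp_singleton]
      simp [A', regFamily]
    have e2 : prodOp A (regEJ e) = prodOp A' (regEJ e) := by
      refine prodOp_congr fun i hi => ?_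
      cases i with
      | none => rfl
      | some i =>
        have : i ≠ 0 := by rintro rfl; simp at hi
        simp [A, A', regFamily, this]
    rw [e1, e2, tensor_prodOp A' _ _ disjoint_regM_regEJ regM_union_regEJ,
      ← tensor_prodOp A' (Finset.subset_univ (regME e)) (Finset.subset_univ {none})
        disjoint_regME_none regME_union_none, prodOp_singleton, blockSum_eq_sum_bra]
    exact tensor_one_eq_sum_bra b _ _
  have hVA : ∀ j, V j * prodOp A' (regME e) * (V j)ᴴ =
      (piTensor (Function.update (fun _ : Fin (e + 1) => σ) j ρ)).submatrix
        (copiesIdx e D (e + 1)) (copiesIdx e D (e + 1)) := by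
    intro j
    rw [one_submatrix_mul_mul, prodOp_submatrix_permuteCopies, prodOp_regFamily_regME, inv_inv]
    congr 2
    funext i
    have hi : j.cycleRange i = 0 ↔ i = j := by
      rw [← Fin.cycleRange_self j, (j.cycleRange).injective.eq_iff]
    by_cases hij : i = j
    · subst hij
      simp
    · rw [Function.update_of_ne (by rwa [Ne, hi]), Function.update_of_ne hij]
  have hred : reduce (regME e) (blockSum b V * tensor (K := regM e) (L := Finset.univ)
      (Finset.subset_univ _) (Finset.subset_univ _) (single (some 0) ρ) (prodOp A (regEJ e)) *
        (blockSum b V)ᴴ) = (convexSplit (Fin (e + 1)) ρ σ).submatrix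
        (copiesIdx e D (e + 1)) (copiesIdx e D (e + 1)) := by
    rw [hX, Matrix.mul_smul, Matrix.smul_mul, conjTranspose_blockSum, blockSum_mul_blockSum,
      blockSum_mul_blockSum, reduce_regME, ← sum_bra_mul_mul _ b]
    simp only [Matrix.mul_smul, Matrix.smul_mul]
    rw [← Finset.smul_sum, sum_bra_mul_mul, partialTrace_blockSum]
    simp only [hVA]
    ext x y
    simp [convexSplit, Matrix.sum_apply]
  have hdE : Disjoint (regE e) (regJ e) := by simp [regE]
  have huE : regE e ∪ regJ e = regEJ e := by
    ext i
    cases i <;> simp [regE, regEJ]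
  have hdM : Disjoint (regM e) (regE e) := by simp [regE]
  have huM : regM e ∪ regE e = regME e := by
    ext i
    cases i with
    | none => simp [regE, regME]
    | some i => by_cases hi : i = 0 <;> simp [regE, regME, hi]
  refine ⟨prodOp A (regEJ e), blockSum b V, prodOp A (regME e),
    ⟨⟨prodOp_mem_free A hA ⟨none, by simp⟩, h.blockSum_mem_freeOps hV,
      prodOp_mem_free A hA ⟨some 0, by simp⟩, ?_⟩,
      prodOp A (regE e), prodOp A (regJ e), prodOp A (regM e), ?_, ?_, ?_, ?_, ?_⟩, V, hV, rfl⟩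
  · rw [hred, prodOp_regFamily_regME]
    refine (purifiedDistance_submatrix_le _ (isState_convexSplit hρ hσs).1
      (isState_piTensor fun _ => hσs).1).trans ?_
    exact purifiedDistance_convexSplit_le hρ hρ' hσs hε hδ hP hK (by simpa using hcard)
  · rcases (regE e).eq_empty_or_nonempty with hE | hE
    · rw [hE]; exact isState_prodOp_empty A
    · exact T.isState _ hE _ (prodOp_mem_free A hA hE)
  · exact T.isState _ ⟨none, by simp⟩ _ (prodOp_mem_free A hA ⟨none, by simp⟩)
  · exact prodOp_mem_free A hA ⟨some 0, by simp⟩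
  · exact (tensor_prodOp A _ _ hdE huE).symm
  · exact (tensor_prodOp A _ _ hdM huM).symm

end

end ResourceTheory

/-! ### Passage to the framework -/

namespace ResourceFramework

variable {S : Type*} (R : ResourceFramework S)

theorem isClosed_free (M : S) : IsClosed (R.free M) := by
  -- Any decomposition containing `M` will do; the smallest has one copy of `M` and a trivial last
  -- register.
  have h := R.theory_freeSingle (fun _ : Fin 1 => M) 1 one_pos 0
  have hc : IsClosed ((R.theory (fun _ : Fin 1 => M) 1 one_pos).freeSingle (some 0)) :=
    ((R.theory (fun _ : Fin 1 => M) 1 one_pos).closed {some 0} ⟨some 0, by simp⟩).preimage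
      (continuous_single (some 0))
  rwa [h] at hc

theorem isState_of_mem_free {M : S} {σ : Matrix (Fin (R.dim M)) (Fin (R.dim M)) ℂ}
    (hσ : σ ∈ R.free M) : IsState σ := by
  have h := R.theory_freeSingle (fun _ : Fin 1 => M) 1 one_pos 0
  have hσ' : σ ∈ (R.theory (fun _ : Fin 1 => M) 1 one_pos).freeSingle (some 0) := by
    rw [h]; exact hσ
  exact (isState_single_iff (d := regDim (fun _ : Fin 1 => R.dim M) 1) (some 0) σ).mp
    ((R.theory (fun _ : Fin 1 => M) 1 one_pos).isState {some 0} ⟨some 0, by simp⟩ _ hσ')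

/-- Constancy of `s` is a hypothesis because `Fin.cons M (fun _ => M)` is not constant by
definition; after substitution all registers have literally the same dimension. -/
theorem exists_isCatalyticTransformation {e : ℕ} (s : Fin (e + 1) → S)
    (hs : ∃ M, s = fun _ => M)
    {b : OrthonormalBasis (Fin (e + 1)) ℂ (EuclideanSpace ℂ (Fin (e + 1)))}
    (h : (R.theory s (e + 1) e.succ_pos).ClassicalRandomness b)
    {ρ ρ' σ : Matrix (Fin (R.dim (s 0))) (Fin (R.dim (s 0))) ℂ} (hρ : IsState ρ)
    (hρ' : IsState ρ') (hσ : σ ∈ R.free (s 0)) {K ε δ : ℝ} (hε : 0 ≤ ε) (hδ : 0 < δ)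
    (hP : purifiedDistance ρ ρ' ≤ ε) (hK : (K • σ - ρ').PosSemidef)
    (hcard : K / δ ^ 2 < (e + 1 : ℕ) + 1) :
    ∃ μ U τ, (R.theory s (e + 1) e.succ_pos).IsCatalyticTransformation (ε + δ) ρ μ U τ ∧
      U ∈ (R.theory s (e + 1) e.succ_pos).controlledOps b := by
  obtain ⟨M, rfl⟩ := hs
  exact h.exists_isCatalyticTransformation (R.theory_freeSingle (fun _ => M) (e + 1) e.succ_pos)
    hρ hρ' hσ hε hδ hP hK hcard

end ResourceFramework

theorem two_rpow_add_two_mul_logb (k : ℝ) {δ : ℝ} (hδ : 0 < δ) :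
    (2 : ℝ) ^ (k + 2 * Real.logb 2 (1 / δ)) = 2 ^ k / δ ^ 2 := by
  rw [Real.rpow_add two_pos, mul_comm 2, Real.rpow_mul two_pos.le,
    Real.rpow_logb two_pos (by norm_num) (by positivity), Real.rpow_two, one_div, inv_pow,
    div_eq_mul_inv]

end Catalytic

end

theorem theorem1 {S : Type*} (R : Catalytic.ResourceFramework S) (M : S)
    (ρ : Matrix (Fin (R.dim M)) (Fin (R.dim M)) ℂ) (hρ : Catalytic.IsState ρ)
    (ε δ : ℝ) (hε : 0 < ε) (hδ : 0 < δ) :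
    -- the minimum over the free states of `M` is attained
    ((R.free M).Nonempty →
      ∃ σ ∈ R.free M, Catalytic.smoothDMax ε ρ σ = Catalytic.resourceDMax ε ρ (R.free M)) ∧
    -- achievability
    (∀ b : Catalytic.BasisChoice S,
      (∀ {e : ℕ} (s : Fin (e + 1) → S) (ℓ : ℕ) (hℓ : 0 < ℓ),
        (R.theory s ℓ hℓ).ClassicalRandomness (b s ℓ)) →
      ∀ k : ℝ, Catalytic.resourceDMax ε ρ (R.free M) = (k : EReal) →
        0 ≤ k + 2 * Real.logb 2 (1 / δ) →
        ∃ (e : ℕ) (t : Fin e → S) (ℓ : ℕ) (hℓ : 0 < ℓ),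
          ℓ = ⌊(2 : ℝ) ^ (k + 2 * Real.logb 2 (1 / δ))⌋₊ ∧
          ∃ μ U σ,
            (R.theory (Fin.cons M t) ℓ hℓ).IsCatalyticTransformation (ε + δ) ρ μ U σ ∧
            U ∈ (R.theory (Fin.cons M t) ℓ hℓ).controlledOps (b (Fin.cons M t) ℓ)) ∧
    -- converse when the last register is a source of classical randomness
    (∀ (e : ℕ) (t : Fin e → S) (ℓ : ℕ) (hℓ : 0 < ℓ)
      (b : OrthonormalBasis (Fin ℓ) ℂ (EuclideanSpace ℂ (Fin ℓ))),
      (R.theory (Fin.cons M t) ℓ hℓ).ClassicalRandomness b →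
      ∀ μ U σ, (R.theory (Fin.cons M t) ℓ hℓ).IsTransformation ε ρ μ U σ →
        U ∈ (R.theory (Fin.cons M t) ℓ hℓ).controlledOps b →
        Catalytic.resourceDMax ε ρ (R.free M) ≤ (Real.logb 2 ℓ : EReal)) ∧
    -- converse in general
    (∀ (e : ℕ) (t : Fin e → S) (ℓ : ℕ) (hℓ : 0 < ℓ),
      ∀ μ U σ, (R.theory (Fin.cons M t) ℓ hℓ).IsTransformation ε ρ μ U σ →
        ((1 / 2 : ℝ) : EReal) * Catalytic.resourceDMax ε ρ (R.free M) ≤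
          (Real.logb 2 ℓ : EReal)) := by
  have hclosed := R.isClosed_free M
  have hstate : ∀ σ ∈ R.free M, Catalytic.IsState σ := fun σ hσ => R.isState_of_mem_free hσ
  have hfree : ∀ (e : ℕ) (t : Fin e → S) (ℓ : ℕ) (hℓ : 0 < ℓ),
      (R.theory (Fin.cons M t) ℓ hℓ).freeSingle (some 0) = R.free M :=
    fun e t ℓ hℓ => R.theory_freeSingle (Fin.cons M t) ℓ hℓ 0
  refine ⟨Catalytic.exists_smoothDMax_eq_resourceDMax hε.le hρ hclosed hstate, ?_, ?_, ?_⟩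
  · intro b hb k hk hkδ
    obtain ⟨x, ρ', σ, hσ, hρ', hP, hx, hEq⟩ := Catalytic.exists_resourceDMax_eq hε.le hρ hclosed
      hstate (by rw [hk]; exact EReal.coe_ne_top k)
    obtain rfl : k = x := by rw [hk] at hEq; exact_mod_cast hEq
    -- The assumption `k + 2 log (1/δ) ≥ 0` ensures that there is at least one copy.
    have hpos : 0 < ⌊(2 : ℝ) ^ (k + 2 * Real.logb 2 (1 / δ))⌋₊ :=
      Nat.floor_pos.mpr (Real.one_le_rpow one_le_two hkδ)
    obtain ⟨e, he⟩ := Nat.exists_eq_succ_of_ne_zero hpos.ne'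
    -- `2^k/δ² < ℓ + 1` is all that the convex split bound needs, so rounding down suffices.
    have hlt := Nat.lt_floor_add_one ((2 : ℝ) ^ (k + 2 * Real.logb 2 (1 / δ)))
    rw [he, Catalytic.two_rpow_add_two_mul_logb k hδ] at hlt
    refine ⟨e, fun _ => M, e + 1, e.succ_pos, he.symm, ?_⟩
    refine R.exists_isCatalyticTransformation (Fin.cons M fun _ => M) ⟨M, ?_⟩
      (hb (Fin.cons M fun _ => M) (e + 1) e.succ_pos) hρ hρ' hσ hε.le hδ hP hx hlt
    funext i
    refine Fin.cases rfl (fun _ => rfl) i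
  · intro e t ℓ hℓ b hb μ U σ hT hU
    have := hb.resourceDMax_le hℓ hρ hT hU
    rwa [hfree] at this
  · intro e t ℓ hℓ μ U σ hT
    have h := (R.theory (Fin.cons M t) ℓ hℓ).resourceDMax_le_of_isTransformation hℓ hρ hT
    rw [hfree] at h
    have h2 : Real.logb 2 ((ℓ : ℝ) ^ 2) = 2 * Real.logb 2 ℓ := by
      rw [Real.logb_pow]; norm_num
    rw [h2] at h
    have h3 := mul_le_mul_of_nonneg_left h
      (show (0 : EReal) ≤ ((1 / 2 : ℝ) : EReal) by exact_mod_cast (by norm_num : (0 : ℝ) ≤ 1 / 2))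
    refine h3.trans (le_of_eq ?_)
    rw [← EReal.coe_mul]
    congr 1
    ring
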